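/- **Setting.** There are $n\ge 1$ users and $m\ge 1$ channels, slots $t=1,2,\dots$, and $s=\max\{n,m\}$. In slot $t$ link $(i,j)$ succeeds ($S_{i,j}(t)=1$, otherwise $0$) with probability $q_{i,j}(t)$, independently over links and slots. In each slot the controller picks an assignment $Y(t)\in\{0,1\}^{n\times m}$ with all row and column sums at most $1$; the successes are $X_i(t)=\sum_j Y_{i,j}(t)S_{i,j}(t)$. The utility $\phi$ is concave and entrywise nondecreasing on $[0,1]^n$ and has at each point of $[0,1]^n$ a supergradient with all entries at most $B$ in absolute value. For constant success probabilities $p=(p_{i,j})$, $\phi^{\mathrm{opt}}=\phi^{\mathrm{opt}}(p)$ is the supremum of $\liminf_{T\to\infty}\phi\big(\frac1T\sum_{t=1}^T\mathbb E\{X(t)\}\big)$ over all random assignment sequences such that $Y(t)$ and $S(\tau)$ are independent for $\tau\ge t$, and, for $\tau<t$, $Y(t)$ and $S_{i,j}(\tau)$ are independent given $Y_{i,j}(\tau)\ne1$. **Algorithm (Adaptive MAC)** with parameters $\eta,V>0$ and $\varepsilon\in(0,1/s)$. Let $\mathcal S^{\rm row}_\varepsilon$ ($\mathcal S^{\rm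 col}_\varepsilon$) be the set of row (column) stochastic $s\times s$ matrices with all entries at least $\varepsilon$, and $D(X\|Y)=\sum_{i,j}X_{i,j}\log(X_{i,j}/Y_{i,j})$. Start with any $\tilde P(1)\in\mathcal S^{\rm row}_\varepsilon\cap\mathcal S^{\rm col}_\varepsilon$ and $Q(1)\in[0,BV+1]^n$. In slot $t$: put $P(t)=\mathrm{ROUND}(\tilde P(t))$; write $P(t)$ as a convex combination of permutation matrices, sample one of them (freshly) with these weights, and let $Y(t)$ be its upper left $n\times m$ block; put $\hat S_{i,j}(t)=S_{i,j}(t)Y_{i,j}(t)/P_{i,j}(t)$; choose $$\gamma(t+1)\in\arg\min_{\gamma\in[0,1]^n}\Big[-V\phi(\gamma)+\sum_{i=1}^n Q_i(t)\gamma_i\Big],$$ $$\tilde P(t+1)=\arg\min_{P\in\mathcal Q}\Big[-\sum_{i=1}^n\sum_{j=1}^m Q_i(t)\hat S_{i,j}(t)P_{i,j}+\tfrac1\eta D(P\|\tilde P(t))\Big],$$ with $\mathcal Q=\mathcal S^{\rm col}_\varepsilon$ for even $t$ and $\mathcal Q=\mathcal S^{\rm row}_\varepsilon$ for odd $t$;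 put $Q_i(t+1)=\max\{Q_i(t)+\gamma_i(t+1)-X_i(t),0\}$. Here $\mathrm{ROUND}(P)$ divides each row of $P$ with sum above $1$ by its sum, then each column of the result with sum above $1$ by its sum, which gives $P''$, and returns $P''+\frac1C(\mathbf 1-P''\mathbf 1)(\mathbf 1-P''^{\top}\mathbf 1)^{\top}$ with $C=\|\mathbf 1-P''\mathbf 1\|_1$ (and $P''$ if $C=0$). **Theorem.** Let $T,T_0\ge1$ and suppose that $q(t)=p$ for all $t\in\{T_0,\dots,T_0+T-1\}$, while the success probabilities outside this window are arbitrary. Then, for all $\varepsilon\in(0,1/s)$ and $\eta,V>0$, the algorithm yields $$\phi^{\mathrm{opt}}(p)-\phi\Big(\mathbb E\Big\{\frac1T\sum_{t=T_0}^{T+T_0-1}X(t)\Big\}\Big)\le \frac nV+\frac{9\eta nms^2}{2\varepsilon V}(BV+1)^2+\frac{\varepsilon nms(BV+1)}{V}+\frac{s}{\eta VT}\log\frac1\varepsilon+\frac{n(BV+1)^2}{2VT}+\frac{nB(BV+1)}{T}.$$ In particular, for all constants $0<c_1\le c_2$ there is a constant $C$, depending only on $n,m,B,c_1,c_2$, such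 that: 1. If $q(t)=p$ for all $t\ge 1$, $\delta>0$, $c_1/\delta\le V\le c_2/\delta$, $c_1\delta\le\varepsilon\le c_2\delta$, $\varepsilon<1/s$ and $c_1\delta^3\le\eta\le c_2\delta^3$, then $$\phi^{\mathrm{opt}}(p)-\liminf_{T\to\infty}\phi\Big(\mathbb E\Big\{\frac1T\sum_{t=1}^{T}X(t)\Big\}\Big)\le C\delta.$$ 2. If $T_0\ge1$, $T\ge2$, $q(t)=p$ for all $t\in\{T_0,\dots,T_0+T-1\}$, $c_1T^{1/3}\le V\le c_2T^{1/3}$, $c_1T^{-1/3}\le\varepsilon\le c_2T^{-1/3}$, $\varepsilon<1/s$ and $c_1/T\le\eta\le c_2/T$, then $$\phi^{\mathrm{opt}}(p)-\phi\Big(\mathbb E\Big\{\frac1T\sum_{t=T_0}^{T+T_0-1}X(t)\Big\}\Big)\le C\,\frac{\log T}{T^{1/3}}.$$ -/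

import Mathlib

open MeasureTheory ProbabilityTheory Filter

universe u

namespace AdaptiveMAC

/-- The unit cube `[0,1]^n`. -/
def cube (n : ℕ) : Set (Fin n → ℝ) := {x | ∀ i, 0 ≤ x i ∧ x i ≤ 1}

/-- The standing assumption on the utility: on `[0,1]^n` it is concave, entrywise nondecreasing, and
has at every point a (super)gradient whose entries are bounded by `B` in absolute value. -/
structure IsUtility {n : ℕ} (φ : (Fin n → ℝ) → ℝ) (B : ℝ) : Prop where
  concave : ConcaveOn ℝ (cube n) φ
  mono : MonotoneOn φ (cube n)
  bounded_subgradients : ∀ x ∈ cube n, ∃ g : Fin n → ℝ,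
    (∀ y ∈ cube n, φ y ≤ φ x + ∑ i, g i * (y i - x i)) ∧ ∀ i, |g i| ≤ B

/-! ### The channel and the benchmark -/

/-- `S t ω i j ∈ {0,1}` tells whether the link between user `i` and channel `j` is successful in
slot `t`. All links in all slots `t ≥ 1` are independent, and link `(i,j)` succeeds in slot `t` with
probability `q t i j`. -/
structure IsSuccessProcess {n m : ℕ} {Ω : Type u} [MeasurableSpace Ω] (μ : Measure Ω)
    (q : ℕ → Fin n → Fin m → ℝ) (S : ℕ → Ω → Fin n → Fin m → ℝ) : Prop where
  measurable : ∀ t, 1 ≤ t → Measurable (S t)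
  zero_one : ∀ t, 1 ≤ t → ∀ ω i j, S t ω i j = 0 ∨ S t ω i j = 1
  prob : ∀ t, 1 ≤ t → ∀ i j, μ.real {ω | S t ω i j = 1} = q t i j
  indep : iIndepFun
    (fun (k : {t : ℕ // 1 ≤ t} × Fin n × Fin m) ω => S k.1.1 ω k.2.1 k.2.2) μ

/-- The number of successes `X_i = ∑_j Y_{i,j} S_{i,j}` of every user in one slot. -/
def successes {n m : ℕ} (Y S : Fin n → Fin m → ℝ) (i : Fin n) : ℝ := ∑ j, Y i j * S i j

/-- The sequence of (random) assignments `Y 1, Y 2, …` is feasible for the success probabilities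
`p`, constant in time. -/
structure IsFeasible {n m : ℕ} {Ω : Type u} [MeasurableSpace Ω] (μ : Measure Ω)
    (p : Fin n → Fin m → ℝ) (S Y : ℕ → Ω → Fin n → Fin m → ℝ) : Prop where
  success : IsSuccessProcess μ (fun _ => p) S
  measurable : ∀ t, 1 ≤ t → Measurable (Y t)
  /-- Assignments do not know successes before they happen. -/
  indep_future : ∀ t τ, 1 ≤ t → t ≤ τ → IndepFun (Y t) (S τ) μ
  /-- Assignments do not use successes that were not observed: given that `(i,j)` was not assigned
  in slot `τ`, the later assignment `Y t` is independent of `S τ i j`. -/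
  indep_past : ∀ t τ, 1 ≤ τ → τ < t → ∀ i j,
    IndepFun (Y t) (fun ω => S τ ω i j) (ProbabilityTheory.cond μ {ω | Y τ ω i j ≠ 1})
  zero_one : ∀ t, 1 ≤ t → ∀ ω i j, Y t ω i j = 0 ∨ Y t ω i j = 1
  sum_user_le : ∀ t, 1 ≤ t → ∀ ω j, ∑ i, Y t ω i j ≤ 1
  sum_channel_le : ∀ t, 1 ≤ t → ∀ ω i, ∑ j, Y t ω i j ≤ 1

/-- The objective `liminf_T φ((1/T) ∑_{t=1}^T E X(t))` of a sequence of assignments. -/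
noncomputable def objective {n m : ℕ} {Ω : Type u} [MeasurableSpace Ω] (μ : Measure Ω)
    (φ : (Fin n → ℝ) → ℝ) (S Y : ℕ → Ω → Fin n → Fin m → ℝ) : ℝ :=
  liminf (fun T : ℕ => φ (fun i =>
    (1 / (T : ℝ)) * ∑ t ∈ Finset.Icc 1 T, ∫ ω, successes (Y t ω) (S t ω) i ∂μ)) atTop

/-- The optimal utility `φ^opt` for the success probabilities `p`. -/
noncomputable def phiOpt {n m : ℕ} (φ : (Fin n → ℝ) → ℝ) (p : Fin n → Fin m → ℝ) : ℝ :=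
  sSup {v | ∃ (Ω : Type) (_ : MeasurableSpace Ω) (μ : Measure Ω) (_ : IsProbabilityMeasure μ)
    (S Y : ℕ → Ω → Fin n → Fin m → ℝ), IsFeasible μ p S Y ∧ v = objective μ φ S Y}

/-! ### Matrices -/

/-- Row stochastic matrices with all entries at least `ε`. -/
def rowStochastic (s : ℕ) (ε : ℝ) : Set (Matrix (Fin s) (Fin s) ℝ) :=
  {P | (∀ i j, 0 ≤ P i j) ∧ (∀ i, ∑ k, P i k = 1) ∧ ∀ i j, ε ≤ P i j}

/-- Column stochastic matrices with all entries at least `ε`. -/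
def colStochastic (s : ℕ) (ε : ℝ) : Set (Matrix (Fin s) (Fin s) ℝ) :=
  {P | (∀ i j, 0 ≤ P i j) ∧ (∀ j, ∑ k, P k j = 1) ∧ ∀ i j, ε ≤ P i j}

/-- Doubly stochastic matrices with all entries at least `ε`. -/
def doublyStochastic (s : ℕ) (ε : ℝ) : Set (Matrix (Fin s) (Fin s) ℝ) :=
  colStochastic s ε ∩ rowStochastic s ε

/-- The divergence `D(X ‖ Y) = ∑ X_{i,j} log (X_{i,j} / Y_{i,j})`. -/
noncomputable def divergence {s : ℕ} (X Y : Matrix (Fin s) (Fin s) ℝ) : ℝ :=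
  ∑ i, ∑ j, X i j * Real.log (X i j / Y i j)

/-- First step of ROUND: scale down the rows whose sum exceeds `1`. -/
noncomputable def rowNormalize {s : ℕ} (P : Matrix (Fin s) (Fin s) ℝ) :
    Matrix (Fin s) (Fin s) ℝ :=
  fun i j => if 1 < ∑ l, P i l then P i j / ∑ l, P i l else P i j

/-- Second step of ROUND: scale down the columns whose sum exceeds `1`. -/
noncomputable def colNormalize {s : ℕ} (P : Matrix (Fin s) (Fin s) ℝ) :
    Matrix (Fin s) (Fin s) ℝ :=
  fun i j => if 1 < ∑ k, P k j then P i j / ∑ k, P k j else P i j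

/-- Third step of ROUND: add a rank-one matrix that restores the row and column sums. -/
noncomputable def fillUp {s : ℕ} (P : Matrix (Fin s) (Fin s) ℝ) : Matrix (Fin s) (Fin s) ℝ :=
  fun i j =>
    if ∑ k, |1 - ∑ l, P k l| ≠ 0 then
      P i j + (1 - ∑ l, P i l) * (1 - ∑ k, P k j) / ∑ k, |1 - ∑ l, P k l|
    else P i j

/-- The function ROUND. -/
noncomputable def roundMatrix {s : ℕ} (P : Matrix (Fin s) (Fin s) ℝ) : Matrix (Fin s) (Fin s) ℝ :=
  fillUp (colNormalize (rowNormalize P))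

/-- The index of user `i` among the `s = max n m` rows. -/
def userIdx {n m : ℕ} (i : Fin n) : Fin (max n m) := Fin.castLE (le_max_left n m) i

/-- The index of channel `j` among the `s = max n m` columns. -/
def chanIdx {n m : ℕ} (j : Fin m) : Fin (max n m) := Fin.castLE (le_max_right n m) j

/-- The assignment read off from a permutation of `s = max n m` indices: the surplus rows or columns
of its permutation matrix are discarded. -/
noncomputable def assignment {n m : ℕ} (π : Equiv.Perm (Fin (max n m))) (i : Fin n) (j : Fin m) :
    ℝ :=
  π.permMatrix ℝ (userIdx i) (chanIdx j)

/-- The estimator `Ŝ_{i,j} = S_{i,j} Y_{i,j} / P_{i,j}`. -/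
noncomputable def estimator {n m : ℕ} (P : Matrix (Fin (max n m)) (Fin (max n m)) ℝ)
    (Y S : Fin n → Fin m → ℝ) (i : Fin n) (j : Fin m) : ℝ :=
  S i j * Y i j / P (userIdx i) (chanIdx j)

/-! ### The algorithm -/

/-- A run of the algorithm Adaptive MAC with parameters `V, η, ε` on a probability space, against a
channel with success probabilities `q t` in slot `t`. Slots are numbered from `1`; `ℱ t` is the
information available before slot `t`. -/
structure Run {n m : ℕ} (φ : (Fin n → ℝ) → ℝ) (B V η ε : ℝ) (q : ℕ → Fin n → Fin m → ℝ)
    {Ω : Type u} [mΩ : MeasurableSpace Ω] (μ : Measure Ω) where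
  ℱ : Filtration ℕ mΩ
  /-- the successes -/
  S : ℕ → Ω → Fin n → Fin m → ℝ
  /-- the matrices before rounding -/
  Pt : ℕ → Ω → Matrix (Fin (max n m)) (Fin (max n m)) ℝ
  /-- the virtual queues -/
  Q : ℕ → Ω → Fin n → ℝ
  /-- the auxiliary variables -/
  γ : ℕ → Ω → Fin n → ℝ
  /-- the weights of the decomposition into permutation matrices -/
  w : ℕ → Ω → Equiv.Perm (Fin (max n m)) → ℝ
  /-- the sampled permutation -/
  π : ℕ → Ω → Equiv.Perm (Fin (max n m))
  -- The channel.
  success : IsSuccessProcess μ q S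
  -- Measurability.
  measurable_Pt : ∀ t, 1 ≤ t → ∀ i j, Measurable[ℱ t] (fun ω => Pt t ω i j)
  measurable_Q : ∀ t, 1 ≤ t → ∀ i, Measurable[ℱ t] (fun ω => Q t ω i)
  measurable_w : ∀ t, 1 ≤ t → ∀ ρ, Measurable[ℱ t] (fun ω => w t ω ρ)
  measurable_γ : ∀ t, 1 ≤ t → ∀ i, Measurable[ℱ (t + 1)] (fun ω => γ (t + 1) ω i)
  measurable_S : ∀ t, 1 ≤ t → ∀ i j, Measurable[ℱ (t + 1)] (fun ω => S t ω i j)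
  measurable_π : ∀ t, 1 ≤ t → ∀ ρ, MeasurableSet[ℱ (t + 1)] {ω | π t ω = ρ}
  -- Initialization.
  init_Pt : ∀ ω, Pt 1 ω ∈ doublyStochastic (max n m) ε
  init_Q : ∀ ω i, 0 ≤ Q 1 ω i ∧ Q 1 ω i ≤ B * V + 1
  -- Decomposition of the rounded matrix into permutation matrices.
  w_nonneg : ∀ t, 1 ≤ t → ∀ ω ρ, 0 ≤ w t ω ρ
  w_sum : ∀ t, 1 ≤ t → ∀ ω, ∑ ρ, w t ω ρ = 1
  w_decomp : ∀ t, 1 ≤ t → ∀ ω, roundMatrix (Pt t ω) = ∑ ρ, w t ω ρ • ρ.permMatrix ℝ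
  -- Given the past, the permutation is sampled according to the weights; the successes of the slot
  -- are independent of the past and of the sampled permutation.
  sample : ∀ t, 1 ≤ t → ∀ ρ,
    μ[Set.indicator {ω | π t ω = ρ} (fun _ => (1 : ℝ)) | ℱ t] =ᵐ[μ] fun ω => w t ω ρ
  fresh : ∀ t, 1 ≤ t →
    Indep (MeasurableSpace.comap (S t) inferInstance) (ℱ t ⊔ MeasurableSpace.comap (π t) ⊤) μ
  -- The updates.
  γ_mem : ∀ t, 1 ≤ t → ∀ ω, γ (t + 1) ω ∈ cube n
  γ_min : ∀ t, 1 ≤ t → ∀ ω,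
    IsMinOn (fun g : Fin n → ℝ => -V * φ g + ∑ i, Q t ω i * g i) (cube n) (γ (t + 1) ω)
  Pt_mem : ∀ t, 1 ≤ t → ∀ ω,
    Pt (t + 1) ω ∈ if Even t then colStochastic (max n m) ε else rowStochastic (max n m) ε
  Pt_min : ∀ t, 1 ≤ t → ∀ ω,
    IsMinOn (fun P : Matrix (Fin (max n m)) (Fin (max n m)) ℝ =>
        -(∑ i : Fin n, ∑ j : Fin m,
          Q t ω i * estimator (roundMatrix (Pt t ω)) (assignment (π t ω)) (S t ω) i j *
            P (userIdx i) (chanIdx j)) + (1 / η) * divergence P (Pt t ω))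
      (if Even t then colStochastic (max n m) ε else rowStochastic (max n m) ε) (Pt (t + 1) ω)
  Q_update : ∀ t, 1 ≤ t → ∀ ω i,
    Q (t + 1) ω i =
      max (Q t ω i + γ (t + 1) ω i - successes (assignment (π t ω)) (S t ω) i) 0

/-- The vector `E[(1/T) ∑_{t=T₀}^{T+T₀-1} X(t)]` of a run. -/
noncomputable def Run.mean {n m : ℕ} {φ : (Fin n → ℝ) → ℝ} {B V η ε : ℝ}
    {q : ℕ → Fin n → Fin m → ℝ} {Ω : Type u} [MeasurableSpace Ω] {μ : Measure Ω}
    (R : Run φ B V η ε q μ) (T₀ T : ℕ) (i : Fin n) : ℝ :=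
  ∫ ω, (1 / (T : ℝ)) * ∑ t ∈ Finset.Ico T₀ (T₀ + T),
    successes (assignment (R.π t ω)) (R.S t ω) i ∂μ

end AdaptiveMAC

namespace AdaptiveMAC

/-! ### The divergence -/

/-! The proof is a drift-plus-penalty argument coupled with mirror descent on importance-weighted
estimates. In expectation an assignment sequence matters only through `E Y(t)`, because `Y(t)` is
independent of `S(t)`. So the benchmark is at most the best value of `φ(∑_j A_{ij} p_{ij})` over
doubly substochastic `A` (`phiOpt_le`). Fix such an `A` and a doubly stochastic `W` with entries at
least `ε` that dominates `(1 - εs) A`.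

The potential is `½ ∑ Q_i² + (1/η) D(W ‖ P̃(t))`. Optimality of `γ(t+1)` compares `φ(γ)` with
`φ(Ap)`; what remains is the linear regret of the played matrix against `W`. Since `W` lies in both
constraint sets, the three-point inequality applies in every slot although the sets alternate.
Besides the telescoping divergences it supplies the negative term `-(1/η) D(P̃(t+1) ‖ P̃(t))`.

This term pays for two things: the step from `P̃(t+1)` back to `P̃(t)`, and the rounding. Indeed
`P̃(t+1)` has exactly the row or column sums that `P̃(t)` lacks, so the mass that ROUND removes is
at most `‖P̃(t+1) - P̃(t)‖₁`, which Pinsker's inequality controls by the divergence (`regret_step`).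
ROUND keeps every entry at least `ε/s`, so the second moment of the estimator is at most `s/ε`. The
other fluctuations have mean zero given the past.

Summed over a window the potentials telescope. The queues stay below `BV + 1` on every path
(`Q_mem`), so the potential at the start of any window is bounded whatever happened before, and the
average of `γ` exceeds that of `X` by at most `(BV + 1)/T` in each coordinate. -/

lemma sq_sqrt_sub_sqrt_le {x y : ℝ} (hx : 0 < x) (hy : 0 < y) :
    (√x - √y) ^ 2 ≤ x * Real.log (x / y) - x + y := by
  have hsx := Real.sqrt_pos.2 hx
  have hsy := Real.sqrt_pos.2 hy
  have h1 : Real.log (x / y) = -(2 * Real.log (√y / √x)) := by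
    rw [← Real.sqrt_div hy.le, Real.log_sqrt (by positivity), ← inv_div y x, Real.log_inv]
    ring
  have h2 : Real.log (√y / √x) ≤ √y / √x - 1 := Real.log_le_sub_one_of_pos (by positivity)
  have h3 : x * (√y / √x) = √x * √y := by
    rw [mul_div_assoc', div_eq_iff hsx.ne']
    nlinarith [Real.mul_self_sqrt hx.le]
  have h4 : x * Real.log (√y / √x) ≤ √x * √y - x := by
    have := mul_le_mul_of_nonneg_left h2 hx.le
    rw [mul_sub, h3] at this
    linarith
  rw [h1]
  nlinarith [Real.sq_sqrt hx.le, Real.sq_sqrt hy.le]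

/-- A version of Pinsker's inequality, by way of the Hellinger distance. -/
lemma sq_sum_abs_sub_le_divergence {s : ℕ} {c : ℝ} {X Y : Matrix (Fin s) (Fin s) ℝ}
    (hX : ∀ i j, 0 < X i j) (hY : ∀ i j, 0 < Y i j)
    (hXc : ∑ i, ∑ j, X i j = c) (hYc : ∑ i, ∑ j, Y i j = c) :
    (∑ i, ∑ j, |X i j - Y i j|) ^ 2 ≤ 4 * c * divergence X Y := by
  have hH : ∑ i, ∑ j, (√(X i j) - √(Y i j)) ^ 2 ≤ divergence X Y := by
    calc ∑ i, ∑ j, (√(X i j) - √(Y i j)) ^ 2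
        ≤ ∑ i, ∑ j, (X i j * Real.log (X i j / Y i j) - X i j + Y i j) :=
          Finset.sum_le_sum fun i _ => Finset.sum_le_sum fun j _ =>
            sq_sqrt_sub_sqrt_le (hX i j) (hY i j)
      _ = divergence X Y := by
          simp only [Finset.sum_add_distrib, Finset.sum_sub_distrib, hXc, hYc, divergence]
          ring
  have hS : ∑ i, ∑ j, (√(X i j) + √(Y i j)) ^ 2 ≤ 4 * c := by
    calc ∑ i, ∑ j, (√(X i j) + √(Y i j)) ^ 2
        ≤ ∑ i, ∑ j, (2 * X i j + 2 * Y i j) :=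
          Finset.sum_le_sum fun i _ => Finset.sum_le_sum fun j _ => by
            nlinarith [Real.sq_sqrt (hX i j).le, Real.sq_sqrt (hY i j).le,
              sq_nonneg (√(X i j) - √(Y i j))]
      _ = 4 * c := by
          simp only [Finset.sum_add_distrib, ← Finset.mul_sum, hXc, hYc]
          ring
  have hc : 0 ≤ 4 * c := le_trans (by positivity) hS
  have hD : 0 ≤ divergence X Y := le_trans (by positivity) hH
  -- Factor `|x - y| = |√x - √y| (√x + √y)` and apply Cauchy–Schwarz to the two sums bounded above.
  have e : ∑ i, ∑ j, |X i j - Y i j|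
      = ∑ k : Fin s × Fin s, |√(X k.1 k.2) - √(Y k.1 k.2)| * (√(X k.1 k.2) + √(Y k.1 k.2)) := by
    rw [Fintype.sum_prod_type]
    refine Finset.sum_congr rfl fun i _ => Finset.sum_congr rfl fun j _ => ?_
    rw [← abs_of_nonneg (add_nonneg (Real.sqrt_nonneg (X i j)) (Real.sqrt_nonneg (Y i j))),
      ← abs_mul]
    congr 1
    dsimp only
    nlinarith [Real.sq_sqrt (hX i j).le, Real.sq_sqrt (hY i j).le]
  rw [e]
  refine (Finset.sum_mul_sq_le_sq_mul_sq _ _ _).trans ?_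
  simp only [sq_abs, Fintype.sum_prod_type]
  calc _ ≤ divergence X Y * (4 * c) := by gcongr
    _ = _ := mul_comm _ _

lemma divergence_nonneg {s : ℕ} {X Y : Matrix (Fin s) (Fin s) ℝ}
    (hX : ∀ i j, 0 < X i j) (hY : ∀ i j, 0 < Y i j)
    (h : ∑ i, ∑ j, X i j = ∑ i, ∑ j, Y i j) : 0 ≤ divergence X Y := by
  have : ∑ i, ∑ j, (X i j - Y i j) ≤ divergence X Y :=
    Finset.sum_le_sum fun i _ => Finset.sum_le_sum fun j _ => by
      have := sq_sqrt_sub_sqrt_le (hX i j) (hY i j)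
      nlinarith [sq_nonneg (√(X i j) - √(Y i j))]
  simpa [Finset.sum_sub_distrib, h] using this

/-- The three-point inequality for the minimizer `X` of `-⟨G, P⟩ + (1/η) D(P ‖ Y)` over a convex set
of positive matrices of equal total mass. -/
lemma three_point {s : ℕ} {η : ℝ} (hη : 0 < η) {C : Set (Matrix (Fin s) (Fin s) ℝ)}
    (hC : Convex ℝ C) {ℓ : Matrix (Fin s) (Fin s) ℝ → ℝ} {G X Y W : Matrix (Fin s) (Fin s) ℝ}
    (hℓ : ∀ P, ℓ P = ∑ i, ∑ j, G i j * P i j)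
    (hXC : X ∈ C) (hWC : W ∈ C) (hpos : ∀ P ∈ C, ∀ i j, 0 < P i j) (hY : ∀ i j, 0 < Y i j)
    (hmass : ∑ i, ∑ j, W i j = ∑ i, ∑ j, X i j)
    (hmin : IsMinOn (fun P => -ℓ P + 1 / η * divergence P Y) C X) :
    ℓ W - ℓ X ≤ 1 / η * (divergence W Y - divergence W X - divergence X Y) := by
  -- `a` is the derivative of `D(· ‖ Y)` at `X` in the direction `W - X`, up to a term that vanishes
  -- because the masses agree; `b` is a χ² bound for the second-order term.
  set a : ℝ := ∑ i, ∑ j, (W i j - X i j) * Real.log (X i j / Y i j) with ha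
  set b : ℝ := ∑ i, ∑ j, (W i j - X i j) ^ 2 / X i j with hb
  have key : ∀ r : ℝ, 0 < r → r ≤ 1 → 0 ≤ (-(ℓ W - ℓ X) + 1 / η * a) + r * (1 / η * b) := by
    intro r hr hr1
    set Z : Matrix (Fin s) (Fin s) ℝ := (1 - r) • X + r • W with hZ
    have hZC : Z ∈ C := hC hXC hWC (by linarith) hr.le (by ring)
    have hZe : ∀ i j, Z i j = X i j + r * (W i j - X i j) := by
      intro i j
      simp [hZ]
      ring
    have h1 := hmin hZC
    simp only [Set.mem_ofPred_eq] at h1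
    have h2 : ℓ Z = ℓ X + r * (ℓ W - ℓ X) := by
      simp only [hℓ, hZe, ← Finset.sum_sub_distrib, Finset.mul_sum, ← Finset.sum_add_distrib]
      exact Finset.sum_congr rfl fun i _ => Finset.sum_congr rfl fun j _ => by ring
    have h3 : divergence Z Y ≤ divergence X Y + r * a + r ^ 2 * b := by
      have e0 : ∑ i, ∑ j, r * (W i j - X i j) = 0 := by
        simp only [← Finset.mul_sum, Finset.sum_sub_distrib, hmass, sub_self, mul_zero]
      have : divergence X Y + r * a + r ^ 2 * b
          = ∑ i, ∑ j, (X i j * Real.log (X i j / Y i j)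
            + r * ((W i j - X i j) * Real.log (X i j / Y i j))
            + r ^ 2 * ((W i j - X i j) ^ 2 / X i j) + r * (W i j - X i j)) := by
        simp only [Finset.sum_add_distrib, e0, add_zero, ha, hb, Finset.mul_sum, divergence]
      rw [this, divergence]
      refine Finset.sum_le_sum fun i _ => Finset.sum_le_sum fun j _ => ?_
      have hx := hpos X hXC i j
      have hz := hpos Z hZC i j
      have hy := hY i j
      have e1 : Real.log (Z i j / Y i j)
          = Real.log (X i j / Y i j) + Real.log (Z i j / X i j) := by
        rw [← Real.log_mul (by positivity) (by positivity)]
        congr 1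
        field_simp
      have e2 : Real.log (Z i j / X i j) ≤ Z i j / X i j - 1 :=
        Real.log_le_sub_one_of_pos (by positivity)
      have e3 : Z i j * (Z i j / X i j - 1)
          = r ^ 2 * ((W i j - X i j) ^ 2 / X i j) + r * (W i j - X i j) := by
        rw [hZe]
        field_simp
        ring
      have e4 := mul_le_mul_of_nonneg_left e2 hz.le
      rw [e1, mul_add]
      have e5 : Z i j * Real.log (X i j / Y i j) = X i j * Real.log (X i j / Y i j)
          + r * ((W i j - X i j) * Real.log (X i j / Y i j)) := by
        rw [hZe]
        ring
      linarith
    have h4 : 1 / η * divergence Z Y ≤ 1 / η * (divergence X Y + r * a + r ^ 2 * b) := by gcongr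
    have h5 : 0 ≤ r * ((-(ℓ W - ℓ X) + 1 / η * a) + r * (1 / η * b)) := by
      rw [h2] at h1
      linarith
    exact nonneg_of_mul_nonneg_right h5 hr
  -- First-order optimality: `key` as `r → 0`. If `x < 0`, the explicit step `r = -x / (2 (y - x))`
  -- already makes `x + r y` negative.
  have hlim : 0 ≤ -(ℓ W - ℓ X) + 1 / η * a := by
    by_contra! hneg
    have hbn : 0 ≤ 1 / η * b := by
      have : 0 ≤ b := Finset.sum_nonneg fun i _ => Finset.sum_nonneg fun j _ =>
        div_nonneg (sq_nonneg _) (hpos X hXC i j).le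
      positivity
    set x := -(ℓ W - ℓ X) + 1 / η * a
    set y := 1 / η * b
    have hd : 0 < y - x := by linarith
    have := key (-x / (2 * (y - x))) (div_pos (by linarith) (by linarith))
      ((div_le_one (by linarith)).2 (by linarith))
    have e : x + -x / (2 * (y - x)) * y = x * (1 - y / (2 * (y - x))) := by ring
    rw [e] at this
    have h6 : y / (2 * (y - x)) < 1 := (div_lt_one (by linarith)).2 (by linarith)
    nlinarith
  -- The Bregman identity; it holds entry by entry.
  have ha' : a = divergence W Y - divergence W X - divergence X Y := by
    simp only [ha, divergence, ← Finset.sum_sub_distrib]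
    refine Finset.sum_congr rfl fun i _ => Finset.sum_congr rfl fun j _ => ?_
    have hx := hpos X hXC i j
    have hw := hpos W hWC i j
    have hy := hY i j
    rw [Real.log_div hx.ne' hy.ne', Real.log_div hw.ne' hy.ne', Real.log_div hw.ne' hx.ne']
    ring
  rw [← ha']
  linarith

/-! ### Stochastic matrices and rounding -/

lemma convex_rowStochastic (s : ℕ) (ε : ℝ) : Convex ℝ (rowStochastic s ε) := by
  intro X hX Y hY a b ha hb hab
  refine ⟨fun i j => ?_, fun i => ?_, fun i j => ?_⟩
  · simpa using add_nonneg (mul_nonneg ha (hX.1 i j)) (mul_nonneg hb (hY.1 i j))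
  · simp [Finset.sum_add_distrib, ← Finset.mul_sum, hX.2.1 i, hY.2.1 i, hab]
  · have h1 := mul_le_mul_of_nonneg_left (hX.2.2 i j) ha
    have h2 := mul_le_mul_of_nonneg_left (hY.2.2 i j) hb
    have h3 : ε = a * ε + b * ε := by rw [← add_mul, hab, one_mul]
    simp only [Matrix.add_apply, Matrix.smul_apply, smul_eq_mul]
    linarith

lemma convex_colStochastic (s : ℕ) (ε : ℝ) : Convex ℝ (colStochastic s ε) := by
  intro X hX Y hY a b ha hb hab
  refine ⟨fun i j => ?_, fun i => ?_, fun i j => ?_⟩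
  · simpa using add_nonneg (mul_nonneg ha (hX.1 i j)) (mul_nonneg hb (hY.1 i j))
  · simp [Finset.sum_add_distrib, ← Finset.mul_sum, hX.2.1 i, hY.2.1 i, hab]
  · have h1 := mul_le_mul_of_nonneg_left (hX.2.2 i j) ha
    have h2 := mul_le_mul_of_nonneg_left (hY.2.2 i j) hb
    have h3 : ε = a * ε + b * ε := by rw [← add_mul, hab, one_mul]
    simp only [Matrix.add_apply, Matrix.smul_apply, smul_eq_mul]
    linarith

lemma sum_of_mem_rowStochastic {s : ℕ} {ε : ℝ} {P : Matrix (Fin s) (Fin s) ℝ}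
    (h : P ∈ rowStochastic s ε) : ∑ i, ∑ j, P i j = s := by
  simp [h.2.1]

lemma sum_of_mem_colStochastic {s : ℕ} {ε : ℝ} {P : Matrix (Fin s) (Fin s) ℝ}
    (h : P ∈ colStochastic s ε) : ∑ i, ∑ j, P i j = s := by
  refine Finset.sum_comm.trans ?_
  simp [h.2.1]

lemma le_one_of_mem_rowStochastic {s : ℕ} {ε : ℝ} {P : Matrix (Fin s) (Fin s) ℝ}
    (h : P ∈ rowStochastic s ε) (i j : Fin s) : P i j ≤ 1 :=
  h.2.1 i ▸ Finset.single_le_sum (f := fun k => P i k) (fun k _ => h.1 i k) (Finset.mem_univ j)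

lemma le_one_of_mem_colStochastic {s : ℕ} {ε : ℝ} {P : Matrix (Fin s) (Fin s) ℝ}
    (h : P ∈ colStochastic s ε) (i j : Fin s) : P i j ≤ 1 :=
  h.2.1 j ▸ Finset.single_le_sum (f := fun k => P k j) (fun k _ => h.1 k j) (Finset.mem_univ i)

/-- Doubly substochastic matrices are completed by `fillUp`. -/
lemma fillUp_spec {s : ℕ} {P : Matrix (Fin s) (Fin s) ℝ}
    (hr : ∀ i, ∑ j, P i j ≤ 1) (hc : ∀ j, ∑ i, P i j ≤ 1) :
    (∀ i j, P i j ≤ fillUp P i j) ∧ (∀ i, ∑ j, fillUp P i j = 1) ∧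
      ∀ j, ∑ i, fillUp P i j = 1 := by
  set C := ∑ k, |1 - ∑ l, P k l| with hC
  have hC1 : C = ∑ k, (1 - ∑ l, P k l) :=
    Finset.sum_congr rfl fun k _ => abs_of_nonneg (by linarith [hr k])
  -- The deficits of the rows and of the columns have the same total in a square matrix; hence one
  -- rank-one term repairs both.
  have hC2 : C = ∑ l, (1 - ∑ k, P k l) := by
    rw [hC1, Finset.sum_sub_distrib, Finset.sum_sub_distrib, Finset.sum_comm]
  have hC0 : 0 ≤ C := Finset.sum_nonneg fun _ _ => abs_nonneg _
  by_cases h0 : C = 0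
  · have hf : fillUp P = P := by
      funext i j
      simp [fillUp, ← hC, h0]
    rw [hf]
    refine ⟨fun _ _ => le_rfl, fun i => ?_, fun j => ?_⟩
    · have := (Finset.sum_eq_zero_iff_of_nonneg fun k _ => by linarith [hr k]).1
        (hC1.symm.trans h0) i (Finset.mem_univ i)
      linarith
    · have := (Finset.sum_eq_zero_iff_of_nonneg fun k _ => by linarith [hc k]).1
        (hC2.symm.trans h0) j (Finset.mem_univ j)
      linarith
  · have hf : ∀ i j, fillUp P i j = P i j + (1 - ∑ l, P i l) * (1 - ∑ k, P k j) / C := by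
      intro i j
      simp [fillUp, ← hC, h0]
    refine ⟨fun i j => ?_, fun i => ?_, fun j => ?_⟩
    · rw [hf]
      have : 0 ≤ (1 - ∑ l, P i l) * (1 - ∑ k, P k j) / C :=
        div_nonneg (mul_nonneg (by linarith [hr i]) (by linarith [hc j])) hC0
      linarith
    · simp only [hf, Finset.sum_add_distrib, ← Finset.sum_div, ← Finset.mul_sum, ← hC2]
      field_simp
      ring
    · simp only [hf, Finset.sum_add_distrib, ← Finset.sum_div, ← Finset.sum_mul, ← hC1]
      field_simp
      ring

/-- Rows are already normalized, so only the column step acts; its result is the witness `R`. Column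
`j` loses the excess of its sum over `1`, and since the columns of `P'` sum to `1` this excess is at
most `∑_i |P'_{ij} - P_{ij}|`. A column sum is at most `s`, so entries stay above `ε / s`. Rounding
loss is thus charged to the movement of the iterates. -/
lemma roundMatrix_of_row {s : ℕ} {ε : ℝ} {P P' : Matrix (Fin s) (Fin s) ℝ} (hε : 0 < ε)
    (hP : P ∈ rowStochastic s ε) (hP' : P' ∈ colStochastic s ε) :
    (∀ i j, ε / s ≤ roundMatrix P i j) ∧
      ∃ R : Matrix (Fin s) (Fin s) ℝ, (∀ i j, R i j ≤ P i j) ∧ (∀ i j, R i j ≤ roundMatrix P i j) ∧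
        ∑ i, ∑ j, (P i j - R i j) ≤ ∑ i, ∑ j, |P' i j - P i j| := by
  have h1 : rowNormalize P = P := by
    funext i j
    simp [rowNormalize, hP.2.1 i]
  set R := colNormalize P with hR
  have hle : ∀ i j, R i j ≤ P i j := by
    intro i j
    simp only [hR, colNormalize]
    split_ifs with h
    · exact div_le_self (hP.1 i j) h.le
    · exact le_rfl
  have hcol : ∀ j, ∑ i, R i j = min (∑ i, P i j) 1 := by
    intro j
    simp only [hR, colNormalize]
    split_ifs with h
    · rw [← Finset.sum_div, div_self (by linarith), min_eq_right h.le]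
    · rw [min_eq_left (not_lt.1 h)]
  have hfill := fillUp_spec (P := R)
    (fun i => (Finset.sum_le_sum fun j _ => hle i j).trans (hP.2.1 i).le)
    (fun j => (hcol j).trans_le (min_le_right _ _))
  have hround : roundMatrix P = fillUp R := by rw [roundMatrix, h1]
  rw [hround]
  refine ⟨fun i j => le_trans ?_ (hfill.1 i j), R, hle, hfill.1, ?_⟩
  · have hs : (1 : ℝ) ≤ s := by
      have : 1 ≤ s := Nat.one_le_iff_ne_zero.2 fun h => by subst h; exact i.elim0
      exact_mod_cast this
    simp only [hR, colNormalize]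
    split_ifs with h
    · have hsum : ∑ k, P k j ≤ s := by
        simpa using Finset.sum_le_sum fun k (_ : k ∈ Finset.univ) =>
          le_one_of_mem_rowStochastic hP k j
      have := hP.2.2 i j
      have := hP.1 i j
      gcongr
    · exact (div_le_self hε.le hs).trans (hP.2.2 i j)
  · rw [Finset.sum_comm, Finset.sum_comm (f := fun i j => |P' i j - P i j|)]
    refine Finset.sum_le_sum fun j _ => ?_
    rw [Finset.sum_sub_distrib, hcol]
    have h2 : |∑ i, (P' i j - P i j)| ≤ ∑ i, |P' i j - P i j| := Finset.abs_sum_le_sum_abs _ _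
    rw [Finset.sum_sub_distrib, hP'.2.1 j] at h2
    refine le_trans ?_ h2
    rcases le_total (∑ i, P i j) 1 with h | h
    · simp [min_eq_left h]
    · rw [min_eq_right h, abs_sub_comm]
      exact le_abs_self _

/-- ROUND does not commute with transposition, so this case is separate: the row step acts first,
and afterwards no column sum exceeds `1`, so the column step does nothing. -/
lemma roundMatrix_of_col {s : ℕ} {ε : ℝ} {P P' : Matrix (Fin s) (Fin s) ℝ} (hε : 0 < ε)
    (hP : P ∈ colStochastic s ε) (hP' : P' ∈ rowStochastic s ε) :
    (∀ i j, ε / s ≤ roundMatrix P i j) ∧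
      ∃ R : Matrix (Fin s) (Fin s) ℝ, (∀ i j, R i j ≤ P i j) ∧ (∀ i j, R i j ≤ roundMatrix P i j) ∧
        ∑ i, ∑ j, (P i j - R i j) ≤ ∑ i, ∑ j, |P' i j - P i j| := by
  set R := rowNormalize P with hR
  have hle : ∀ i j, R i j ≤ P i j := by
    intro i j
    simp only [hR, rowNormalize]
    split_ifs with h
    · exact div_le_self (hP.1 i j) h.le
    · exact le_rfl
  have hcol : ∀ j, ∑ i, R i j ≤ 1 := fun j =>
    (Finset.sum_le_sum fun i _ => hle i j).trans (hP.2.1 j).le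
  have h1 : colNormalize R = R := by
    funext i j
    simp [colNormalize, (hcol j).not_gt]
  have hrow : ∀ i, ∑ j, R i j = min (∑ j, P i j) 1 := by
    intro i
    simp only [hR, rowNormalize]
    split_ifs with h
    · rw [← Finset.sum_div, div_self (by linarith), min_eq_right h.le]
    · rw [min_eq_left (not_lt.1 h)]
  have hfill := fillUp_spec (P := R) (fun i => (hrow i).trans_le (min_le_right _ _)) hcol
  have hround : roundMatrix P = fillUp R := by rw [roundMatrix, ← hR, h1]
  rw [hround]
  refine ⟨fun i j => le_trans ?_ (hfill.1 i j), R, hle, hfill.1, ?_⟩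
  · have hs : (1 : ℝ) ≤ s := by
      have : 1 ≤ s := Nat.one_le_iff_ne_zero.2 fun h => by subst h; exact i.elim0
      exact_mod_cast this
    simp only [hR, rowNormalize]
    split_ifs with h
    · have hsum : ∑ k, P i k ≤ s := by
        simpa using Finset.sum_le_sum fun k (_ : k ∈ Finset.univ) =>
          le_one_of_mem_colStochastic hP i k
      have := hP.2.2 i j
      have := hP.1 i j
      gcongr
    · exact (div_le_self hε.le hs).trans (hP.2.2 i j)
  · refine Finset.sum_le_sum fun i _ => ?_
    rw [Finset.sum_sub_distrib, hrow]
    have h2 : |∑ j, (P' i j - P i j)| ≤ ∑ j, |P' i j - P i j| := Finset.abs_sum_le_sum_abs _ _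
    rw [Finset.sum_sub_distrib, hP'.2.1 i] at h2
    refine le_trans ?_ h2
    rcases le_total (∑ j, P i j) 1 with h | h
    · simp [min_eq_left h]
    · rw [min_eq_right h, abs_sub_comm]
      exact le_abs_self _

/-! ### Assignments -/

lemma userIdx_injective {n m : ℕ} : Function.Injective (userIdx (n := n) (m := m)) :=
  Fin.castLE_injective (le_max_left n m)

lemma chanIdx_injective {n m : ℕ} : Function.Injective (chanIdx (n := n) (m := m)) :=
  Fin.castLE_injective (le_max_right n m)

lemma sum_comp_le_sum {α β : Type*} [Fintype α] [Fintype β] {e : α → β}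
    (he : Function.Injective e) {f : β → ℝ} (hf : ∀ b, 0 ≤ f b) : ∑ a, f (e a) ≤ ∑ b, f b := by
  classical
  rw [← Finset.sum_image (f := f) (s := Finset.univ) (g := e) fun _ _ _ _ h => he h]
  exact Finset.sum_le_sum_of_subset_of_nonneg (Finset.subset_univ _) fun b _ _ => hf b

lemma permMatrix_eq_ite {s : ℕ} (σ : Equiv.Perm (Fin s)) (i j : Fin s) :
    σ.permMatrix ℝ i j = if σ i = j then 1 else 0 := by
  simp [Equiv.Perm.permMatrix, PEquiv.toMatrix_apply, eq_comm]

lemma assignment_zero_one {n m : ℕ} (σ : Equiv.Perm (Fin (max n m))) (i : Fin n) (j : Fin m) :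
    assignment σ i j = 0 ∨ assignment σ i j = 1 := by
  rw [assignment, permMatrix_eq_ite]
  split_ifs <;> simp

lemma sum_assignment_le {n m : ℕ} (σ : Equiv.Perm (Fin (max n m))) (i : Fin n) :
    ∑ j, assignment σ i j ≤ 1 := by
  have h := sum_comp_le_sum (chanIdx_injective (n := n) (m := m))
    (f := fun k => σ.permMatrix ℝ (userIdx i) k) fun k => by
      rw [permMatrix_eq_ite]
      split_ifs <;> simp
  refine h.trans ?_
  simp

lemma successes_mem_Icc {n m : ℕ} {Y S : Fin n → Fin m → ℝ} (hY : ∀ i j, Y i j = 0 ∨ Y i j = 1)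
    (hS : ∀ i j, S i j = 0 ∨ S i j = 1) (hsum : ∀ i, ∑ j, Y i j ≤ 1) (i : Fin n) :
    0 ≤ successes Y S i ∧ successes Y S i ≤ 1 := by
  refine ⟨Finset.sum_nonneg fun j _ => ?_, le_trans (Finset.sum_le_sum fun j _ => ?_) (hsum i)⟩
  · rcases hY i j with h | h <;> rcases hS i j with h' | h' <;> simp [h, h']
  · rcases hY i j with h | h <;> rcases hS i j with h' | h' <;> simp [h, h']

lemma integral_of_zero_one {Ω : Type*} [MeasurableSpace Ω] {μ : Measure Ω} [IsProbabilityMeasure μ]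
    {f : Ω → ℝ} (hf : Measurable f) (h01 : ∀ ω, f ω = 0 ∨ f ω = 1) :
    ∫ ω, f ω ∂μ = μ.real {ω | f ω = 1} := by
  have : f = Set.indicator {ω | f ω = 1} (fun _ => (1 : ℝ)) := by
    funext ω
    rcases h01 ω with h | h <;> simp [Set.indicator, h]
  rw [this, integral_indicator_const]
  · simp [Set.indicator]
  · exact hf (measurableSet_singleton 1)

lemma IsSuccessProcess.measurable_apply {n m : ℕ} {Ω : Type u} [MeasurableSpace Ω] {μ : Measure Ω}
    {q : ℕ → Fin n → Fin m → ℝ} {S : ℕ → Ω → Fin n → Fin m → ℝ} (h : IsSuccessProcess μ q S)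
    {t : ℕ} (ht : 1 ≤ t) (i : Fin n) (j : Fin m) : Measurable fun ω => S t ω i j :=
  (measurable_pi_apply j).comp ((measurable_pi_apply i).comp (h.measurable t ht))

lemma IsSuccessProcess.integral_eq {n m : ℕ} {Ω : Type u} [MeasurableSpace Ω] {μ : Measure Ω}
    [IsProbabilityMeasure μ]
    {q : ℕ → Fin n → Fin m → ℝ} {S : ℕ → Ω → Fin n → Fin m → ℝ} (h : IsSuccessProcess μ q S)
    {t : ℕ} (ht : 1 ≤ t) (i : Fin n) (j : Fin m) : ∫ ω, S t ω i j ∂μ = q t i j := by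
  rw [integral_of_zero_one (h.measurable_apply ht i j) fun ω => h.zero_one t ht ω i j,
    h.prob t ht i j]

lemma IsSuccessProcess.nonneg {n m : ℕ} {Ω : Type u} [MeasurableSpace Ω] {μ : Measure Ω}
    {q : ℕ → Fin n → Fin m → ℝ} {S : ℕ → Ω → Fin n → Fin m → ℝ} (h : IsSuccessProcess μ q S)
    {t : ℕ} (ht : 1 ≤ t) (i : Fin n) (j : Fin m) : 0 ≤ q t i j :=
  h.prob t ht i j ▸ measureReal_nonneg

lemma IsSuccessProcess.le_one {n m : ℕ} {Ω : Type u} [MeasurableSpace Ω] {μ : Measure Ω}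
    [IsProbabilityMeasure μ]
    {q : ℕ → Fin n → Fin m → ℝ} {S : ℕ → Ω → Fin n → Fin m → ℝ} (h : IsSuccessProcess μ q S)
    {t : ℕ} (ht : 1 ≤ t) (i : Fin n) (j : Fin m) : q t i j ≤ 1 :=
  h.prob t ht i j ▸ measureReal_le_one

/-! ### The utility -/

lemma IsUtility.nonneg {n : ℕ} {φ : (Fin n → ℝ) → ℝ} {B : ℝ} (h : IsUtility φ B) (hn : 0 < n) :
    0 ≤ B := by
  obtain ⟨g, -, hg⟩ := h.bounded_subgradients 0 fun i => by simp
  exact (abs_nonneg _).trans (hg ⟨0, hn⟩)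

/-- By monotonicity, only the coordinates that exceed those of `x` matter. -/
lemma IsUtility.le_add_of_sub_le {n : ℕ} {φ : (Fin n → ℝ) → ℝ} {B : ℝ} (h : IsUtility φ B)
    (hB : 0 ≤ B) {x y : Fin n → ℝ} (hx : x ∈ cube n) (hy : y ∈ cube n) {c : ℝ} (hc : 0 ≤ c)
    (hxy : ∀ i, y i - x i ≤ c) : φ y ≤ φ x + n * B * c := by
  have hz : (fun i => max (x i) (y i)) ∈ cube n := fun i =>
    ⟨le_max_of_le_left (hx i).1, max_le (hx i).2 (hy i).2⟩
  obtain ⟨g, hg, hgB⟩ := h.bounded_subgradients x hx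
  refine (h.mono hy hz fun i => le_max_right _ _).trans ((hg _ hz).trans ?_)
  have : ∑ i, g i * (max (x i) (y i) - x i) ≤ ∑ _i : Fin n, B * c :=
    Finset.sum_le_sum fun i _ => by
      have h1 : 0 ≤ max (x i) (y i) - x i := sub_nonneg.2 (le_max_left _ _)
      have h2 : max (x i) (y i) - x i ≤ c := by
        rcases max_cases (x i) (y i) with ⟨e, -⟩ | ⟨e, -⟩ <;> rw [e]
        · simpa using hc
        · exact hxy i
      exact mul_le_mul ((le_abs_self _).trans (hgB i)) h2 h1 hB
  simp only [Finset.sum_const, Finset.card_univ, Fintype.card_fin, nsmul_eq_mul] at this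
  linarith

/-! ### One slot of the algorithm -/

namespace Run

variable {n m : ℕ} {φ : (Fin n → ℝ) → ℝ} {B V η ε : ℝ} {q : ℕ → Fin n → Fin m → ℝ}
  {Ω : Type u} [mΩ : MeasurableSpace Ω] {μ : Measure Ω}

/-- A queue grows by at most `1` per slot, and above `BV` it does not grow: the utility gains at
most slope `B` from `γ_i`, which weighs less than the price `Q_i`, so the minimizer has `γ_i = 0`.
-/
lemma Q_mem (R : Run φ B V η ε q μ) (hφ : IsUtility φ B) (hn : 0 < n) (hV : 0 < V) {t : ℕ}
    (ht : 1 ≤ t) (ω : Ω) (i : Fin n) : 0 ≤ R.Q t ω i ∧ R.Q t ω i ≤ B * V + 1 := by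
  have hB := hφ.nonneg hn
  induction t, ht using Nat.le_induction generalizing i with
  | base => exact R.init_Q ω i
  | succ t ht ih =>
    rw [R.Q_update t ht ω i]
    refine ⟨le_max_right _ _, max_le ?_ (by positivity)⟩
    have hX := (successes_mem_Icc (assignment_zero_one (R.π t ω)) (R.success.zero_one t ht ω)
      (sum_assignment_le (R.π t ω)) i).1
    have hγ := R.γ_mem t ht ω
    by_cases hQ : R.Q t ω i ≤ B * V
    · linarith [(hγ i).2]
    · have h0 : R.γ (t + 1) ω i = 0 := by
        set γ := R.γ (t + 1) ω with hγdef
        -- Competitor in the minimization. The supergradient at `γ'`, not at `γ`, bounds the utility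
        -- lost by dropping coordinate `i`.
        set γ' : Fin n → ℝ := Function.update γ i 0 with hγ'
        have hmem : γ' ∈ cube n := fun k => by
          by_cases hk : k = i
          · subst hk
            simp [hγ']
          · simpa [hγ', hk] using hγ k
        have hmin := R.γ_min t ht ω hmem
        simp only [Set.mem_ofPred_eq] at hmin
        obtain ⟨g, hg, hgB⟩ := hφ.bounded_subgradients γ' hmem
        have h1 := hg γ hγ
        have h2 : ∑ k, g k * (γ k - γ' k) = g i * γ i := by
          rw [Finset.sum_eq_single i]
          · simp [hγ']
          · intro k _ hk
            simp [hγ', hk]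
          · simp
        have h3 : ∑ k, R.Q t ω k * γ k - ∑ k, R.Q t ω k * γ' k = R.Q t ω i * γ i := by
          rw [← Finset.sum_sub_distrib, Finset.sum_eq_single i]
          · simp [hγ']
          · intro k _ hk
            simp [hγ', hk]
          · simp
        have h4 : g i * γ i ≤ B * γ i :=
          mul_le_mul_of_nonneg_right ((le_abs_self _).trans (hgB i)) (hγ i).1
        rw [h2] at h1
        have h5 : V * φ γ ≤ V * (φ γ' + B * γ i) := by
          gcongr
          linarith
        have h6 : (R.Q t ω i - B * V) * γ i ≤ 0 := by nlinarith
        by_contra hne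
        have h7 : 0 < γ i := lt_of_le_of_ne (hγ i).1 (Ne.symm hne)
        nlinarith [mul_pos (sub_pos.2 (not_le.1 hQ)) h7]
      rw [h0]
      linarith [(ih i).2]

/-- Before slot `t`, the matrix is column stochastic for odd `t` and row stochastic for even `t`,
and the next one is of the other kind. -/
lemma Pt_mem_cases (R : Run φ B V η ε q μ) {t : ℕ} (ht : 1 ≤ t) (ω : Ω) :
    (R.Pt t ω ∈ rowStochastic (max n m) ε ∧ R.Pt (t + 1) ω ∈ colStochastic (max n m) ε ∧ Even t) ∨
    (R.Pt t ω ∈ colStochastic (max n m) ε ∧ R.Pt (t + 1) ω ∈ rowStochastic (max n m) ε ∧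
      ¬ Even t) := by
  have h1 := R.Pt_mem t ht ω
  rcases Nat.eq_or_lt_of_le ht with h | h
  · subst h
    -- The initial matrix is of both kinds; slot `1` is odd, so the column membership is the one to
    -- keep.
    exact Or.inr ⟨(R.init_Pt ω).1, by simpa using h1, by simp⟩
  · obtain ⟨k, rfl⟩ : ∃ k, t = k + 1 := ⟨t - 1, by omega⟩
    have h2 := R.Pt_mem k (by omega) ω
    by_cases hk : Even k
    · have hk' : ¬ Even (k + 1) := by simpa [Nat.even_add_one] using hk
      simp only [hk, hk', if_true, if_false] at h1 h2
      exact Or.inr ⟨h2, h1, hk'⟩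
    · have hk' : Even (k + 1) := by simpa [Nat.even_add_one] using hk
      simp only [hk, hk', if_true, if_false] at h1 h2
      exact Or.inl ⟨h2, h1, hk'⟩

lemma le_Pt (R : Run φ B V η ε q μ) {t : ℕ} (ht : 1 ≤ t) (ω : Ω) (i j : Fin (max n m)) :
    ε ≤ R.Pt t ω i j := by
  rcases R.Pt_mem_cases ht ω with h | h <;> exact h.1.2.2 i j

lemma Pt_le_one (R : Run φ B V η ε q μ) {t : ℕ} (ht : 1 ≤ t) (ω : Ω) (i j : Fin (max n m)) :
    R.Pt t ω i j ≤ 1 := by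
  rcases R.Pt_mem_cases ht ω with h | h
  · exact le_one_of_mem_rowStochastic h.1 i j
  · exact le_one_of_mem_colStochastic h.1 i j

lemma sum_Pt (R : Run φ B V η ε q μ) {t : ℕ} (ht : 1 ≤ t) (ω : Ω) :
    ∑ i, ∑ j, R.Pt t ω i j = (max n m : ℕ) := by
  rcases R.Pt_mem_cases ht ω with h | h
  · exact sum_of_mem_rowStochastic h.1
  · exact sum_of_mem_colStochastic h.1

lemma roundMatrix_spec (R : Run φ B V η ε q μ) (hε : 0 < ε) {t : ℕ} (ht : 1 ≤ t) (ω : Ω) :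
    (∀ i j, ε / (max n m : ℕ) ≤ roundMatrix (R.Pt t ω) i j) ∧
      ∃ P'' : Matrix (Fin (max n m)) (Fin (max n m)) ℝ, (∀ i j, P'' i j ≤ R.Pt t ω i j) ∧
        (∀ i j, P'' i j ≤ roundMatrix (R.Pt t ω) i j) ∧
        ∑ i, ∑ j, (R.Pt t ω i j - P'' i j) ≤ ∑ i, ∑ j, |R.Pt (t + 1) ω i j - R.Pt t ω i j| := by
  rcases R.Pt_mem_cases ht ω with h | h
  · exact roundMatrix_of_row hε h.1 h.2.1
  · exact roundMatrix_of_col hε h.1 h.2.1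

/-- The mirror descent step, compared with a doubly stochastic `W`. -/
lemma mirror_step (R : Run φ B V η ε q μ) (hη : 0 < η) (hε : 0 < ε)
    {W : Matrix (Fin (max n m)) (Fin (max n m)) ℝ} (hW : W ∈ doublyStochastic (max n m) ε) {t : ℕ}
    (ht : 1 ≤ t) (ω : Ω) (G : Fin n → Fin m → ℝ)
    (hG : ∀ i j, G i j = R.Q t ω i *
      estimator (roundMatrix (R.Pt t ω)) (assignment (R.π t ω)) (R.S t ω) i j) :
    ∑ i, ∑ j, G i j * (W (userIdx i) (chanIdx j) - R.Pt (t + 1) ω (userIdx i) (chanIdx j)) ≤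
      1 / η * (divergence W (R.Pt t ω) - divergence W (R.Pt (t + 1) ω)
        - divergence (R.Pt (t + 1) ω) (R.Pt t ω)) := by
  classical
  set C : Set (Matrix (Fin (max n m)) (Fin (max n m)) ℝ) :=
    if Even t then colStochastic (max n m) ε else rowStochastic (max n m) ε with hC
  -- Double stochasticity of `W` makes it an admissible comparator for either parity.
  have hWC : W ∈ C := by
    rw [hC]
    split_ifs
    exacts [hW.1, hW.2]
  have hconv : Convex ℝ C := by
    rw [hC]
    split_ifs
    exacts [convex_colStochastic _ _, convex_rowStochastic _ _]
  have hpos : ∀ P ∈ C, ∀ i j, 0 < P i j := by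
    rw [hC]
    split_ifs <;> exact fun P hP i j => hε.trans_le (hP.2.2 i j)
  -- The gains extended by zero outside the user–channel block.
  set G' : Matrix (Fin (max n m)) (Fin (max n m)) ℝ := fun k l =>
    ∑ i, ∑ j, if userIdx i = k ∧ chanIdx j = l then G i j else 0 with hG'
  have hlin : ∀ P : Matrix (Fin (max n m)) (Fin (max n m)) ℝ,
      ∑ i, ∑ j, G i j * P (userIdx i) (chanIdx j) = ∑ k, ∑ l, G' k l * P k l := by
    intro P
    simp only [hG', Finset.sum_mul]
    have e1 : ∀ k : Fin (max n m), ∑ l : Fin (max n m), ∑ i : Fin n, ∑ j : Fin m,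
        (if userIdx i = k ∧ chanIdx j = l then G i j else 0) * P k l
        = ∑ i : Fin n, ∑ j : Fin m, if userIdx i = k then G i j * P k (chanIdx j) else 0 := by
      intro k
      rw [Finset.sum_comm]
      refine Finset.sum_congr rfl fun i _ => ?_
      rw [Finset.sum_comm]
      refine Finset.sum_congr rfl fun j _ => ?_
      by_cases h : userIdx i = k <;> simp [h]
    simp only [e1]
    symm
    rw [Finset.sum_comm]
    refine Finset.sum_congr rfl fun i _ => ?_
    rw [Finset.sum_comm]
    refine Finset.sum_congr rfl fun j _ => ?_
    simp
  have key := three_point hη hconv (ℓ := fun P => ∑ i, ∑ j, G i j * P (userIdx i) (chanIdx j))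
    (G := G') hlin (R.Pt_mem t ht ω) hWC hpos (fun i j => hε.trans_le (R.le_Pt ht ω i j))
    ((sum_of_mem_rowStochastic hW.2).trans (R.sum_Pt (by omega) ω).symm)
    (by simpa only [hG] using R.Pt_min t ht ω)
  refine le_of_eq_of_le ?_ key
  simp only [mul_sub, Finset.sum_sub_distrib]

/-- The regret of one slot, with respect to the unrounded matrix, and the loss by rounding. -/
lemma regret_step (R : Run φ B V η ε q μ) (hφ : IsUtility φ B) (hn : 0 < n) (hV : 0 < V)
    (hη : 0 < η) (hε : 0 < ε) [IsProbabilityMeasure μ]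
    {W : Matrix (Fin (max n m)) (Fin (max n m)) ℝ} (hW : W ∈ doublyStochastic (max n m) ε) {t : ℕ}
    (ht : 1 ≤ t) (ω : Ω) (G : Fin n → Fin m → ℝ)
    (hG : ∀ i j, G i j = R.Q t ω i *
      estimator (roundMatrix (R.Pt t ω)) (assignment (R.π t ω)) (R.S t ω) i j) :
    ∑ i, ∑ j, G i j * (W (userIdx i) (chanIdx j) - R.Pt t ω (userIdx i) (chanIdx j))
      + ∑ i, ∑ j, R.Q t ω i * (q t i j * (R.Pt t ω (userIdx i) (chanIdx j)
          - roundMatrix (R.Pt t ω) (userIdx i) (chanIdx j)))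
      ≤ 1 / η * (divergence W (R.Pt t ω) - divergence W (R.Pt (t + 1) ω))
        + (max n m : ℕ) * η * (2 * ∑ i, ∑ j, G i j ^ 2 + 2 * (B * V + 1) ^ 2) := by
  set s : ℝ := ((max n m : ℕ) : ℝ) with hs
  have hs1 : 1 ≤ s := by
    rw [hs]
    exact_mod_cast hn.trans_le (le_max_left n m)
  set P := R.Pt t ω with hP
  set P' := R.Pt (t + 1) ω with hP'
  set K := B * V + 1 with hK
  have hK0 : 0 ≤ K := by
    have := hφ.nonneg hn
    positivity
  set Δ := ∑ i, ∑ j, |P' i j - P i j| with hΔ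
  set N := √(∑ i, ∑ j, G i j ^ 2) with hN
  have hN2 : N ^ 2 = ∑ i, ∑ j, G i j ^ 2 := Real.sq_sqrt (by positivity)
  have hGN : ∀ i j, |G i j| ≤ N := fun i j => by
    refine Real.abs_le_sqrt ?_
    refine le_trans ?_ (Finset.single_le_sum (f := fun i => ∑ j, G i j ^ 2)
      (fun i _ => by positivity) (Finset.mem_univ i))
    exact Finset.single_le_sum (f := fun j => G i j ^ 2) (fun j _ => by positivity)
      (Finset.mem_univ j)
  have hblock : ∀ F : Matrix (Fin (max n m)) (Fin (max n m)) ℝ, (∀ i j, 0 ≤ F i j) →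
      ∑ i : Fin n, ∑ j : Fin m, F (userIdx i) (chanIdx j) ≤ ∑ i, ∑ j, F i j := by
    intro F hF
    refine le_trans (Finset.sum_le_sum fun i _ =>
      sum_comp_le_sum chanIdx_injective fun l => hF (userIdx i) l) ?_
    exact sum_comp_le_sum (userIdx_injective (n := n) (m := m)) (f := fun k => ∑ l, F k l)
      fun k => Finset.sum_nonneg fun l _ => hF k l
  have h1 := R.mirror_step hη hε hW ht ω G hG
  rw [← hP, ← hP'] at h1
  have h2 : ∑ i, ∑ j, G i j * (P' (userIdx i) (chanIdx j) - P (userIdx i) (chanIdx j))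
      ≤ N * Δ := by
    calc _ ≤ ∑ i : Fin n, ∑ j : Fin m,
          N * |P' (userIdx i) (chanIdx j) - P (userIdx i) (chanIdx j)| :=
          Finset.sum_le_sum fun i _ => Finset.sum_le_sum fun j _ =>
            (le_abs_self _).trans (by
              rw [abs_mul]
              exact mul_le_mul_of_nonneg_right (hGN i j) (abs_nonneg _))
      _ = N * ∑ i : Fin n, ∑ j : Fin m,
          |P' (userIdx i) (chanIdx j) - P (userIdx i) (chanIdx j)| := by
          simp only [Finset.mul_sum]
      _ ≤ N * Δ := by
          refine mul_le_mul_of_nonneg_left ?_ (Real.sqrt_nonneg _)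
          exact hblock (fun i j => |P' i j - P i j|) fun i j => abs_nonneg _
  have h3 : ∑ i, ∑ j, R.Q t ω i * (q t i j * (P (userIdx i) (chanIdx j)
          - roundMatrix P (userIdx i) (chanIdx j))) ≤ K * Δ := by
    -- The entries of `P - roundMatrix P` have no sign. Passing through `P''`, which lies below
    -- both, gives nonnegative differences, to which `q ≤ 1` and `Q ≤ K` apply.
    obtain ⟨-, P'', ha, hb, hc⟩ := R.roundMatrix_spec hε ht ω
    calc _ ≤ ∑ i : Fin n, ∑ j : Fin m,
          K * (P (userIdx i) (chanIdx j) - P'' (userIdx i) (chanIdx j)) := by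
          refine Finset.sum_le_sum fun i _ => Finset.sum_le_sum fun j _ => ?_
          have hQ := R.Q_mem hφ hn hV ht ω i
          have hq0 := R.success.nonneg ht i j
          have hq1 := R.success.le_one ht i j
          have hd0 : 0 ≤ P (userIdx i) (chanIdx j) - P'' (userIdx i) (chanIdx j) :=
            sub_nonneg.2 (ha _ _)
          have hd : P (userIdx i) (chanIdx j) - roundMatrix P (userIdx i) (chanIdx j)
              ≤ P (userIdx i) (chanIdx j) - P'' (userIdx i) (chanIdx j) :=
            sub_le_sub_left (hb _ _) _
          have e1 := (mul_le_mul_of_nonneg_left hd hq0).trans (mul_le_of_le_one_left hd0 hq1)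
          exact (mul_le_mul_of_nonneg_left e1 hQ.1).trans (mul_le_mul_of_nonneg_right hQ.2 hd0)
      _ = K * ∑ i : Fin n, ∑ j : Fin m,
          (P (userIdx i) (chanIdx j) - P'' (userIdx i) (chanIdx j)) := by
          simp only [Finset.mul_sum]
      _ ≤ K * Δ := by
          refine mul_le_mul_of_nonneg_left ?_ hK0
          exact (hblock (fun i j => P i j - P'' i j) fun i j => sub_nonneg.2 (ha i j)).trans hc
  have h4 : Δ ^ 2 ≤ 4 * s * divergence P' P :=
    sq_sum_abs_sub_le_divergence (fun i j => hε.trans_le (R.le_Pt (by omega) ω i j))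
      (fun i j => hε.trans_le (R.le_Pt ht ω i j)) (R.sum_Pt (by omega) ω) (R.sum_Pt ht ω)
  -- Young's inequality with weight `4sη`, chosen so that the square of `Δ` is absorbed by the
  -- negative divergence of the mirror step.
  have h5 : (N + K) * Δ ≤ 1 / η * divergence P' P + s * η * (2 * N ^ 2 + 2 * K ^ 2) := by
    have e1 : Δ ^ 2 / (4 * s * η) ≤ 1 / η * divergence P' P := by
      rw [div_le_iff₀ (by positivity)]
      refine h4.trans (le_of_eq ?_)
      field_simp
    have e2 : (N + K) * Δ ≤ Δ ^ 2 / (4 * s * η) + s * η * (N + K) ^ 2 := by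
      have : Δ ^ 2 / (4 * s * η) + s * η * (N + K) ^ 2 - (N + K) * Δ
          = (Δ - 2 * s * η * (N + K)) ^ 2 / (4 * s * η) := by
        field_simp
        ring
      have : 0 ≤ (Δ - 2 * s * η * (N + K)) ^ 2 / (4 * s * η) := by positivity
      linarith
    have e3 : s * η * (N + K) ^ 2 ≤ s * η * (2 * N ^ 2 + 2 * K ^ 2) := by
      gcongr
      nlinarith [sq_nonneg (N - K)]
    linarith
  have h6 : ∑ i, ∑ j, G i j * (W (userIdx i) (chanIdx j) - P (userIdx i) (chanIdx j))
      = ∑ i, ∑ j, G i j * (W (userIdx i) (chanIdx j) - P' (userIdx i) (chanIdx j))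
        + ∑ i, ∑ j, G i j * (P' (userIdx i) (chanIdx j) - P (userIdx i) (chanIdx j)) := by
    simp only [← Finset.sum_add_distrib]
    exact Finset.sum_congr rfl fun i _ => Finset.sum_congr rfl fun j _ => by ring
  rw [hN2] at h5
  rw [h6]
  linarith

/-! ### Expectations in one slot -/

/-- Measurability comes from the weights of the permutation decomposition and avoids the case
distinctions in ROUND. -/
lemma measurable_roundMatrix (R : Run φ B V η ε q μ) {t : ℕ} (ht : 1 ≤ t)
    (i j : Fin (max n m)) : Measurable[R.ℱ t] fun ω => roundMatrix (R.Pt t ω) i j := by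
  have : (fun ω => roundMatrix (R.Pt t ω) i j)
      = fun ω => ∑ ρ, R.w t ω ρ * ρ.permMatrix ℝ i j := by
    funext ω
    rw [R.w_decomp t ht ω, Matrix.sum_apply]
    simp
  rw [this]
  exact Finset.measurable_sum _ fun ρ _ => (R.measurable_w t ht ρ).mul_const _

/-- Splitting over the sampled permutation reduces everything to indicators, whose conditional
expectations are the weights. -/
lemma assignment_eq_sum (R : Run φ B V η ε q μ) (t : ℕ) (ω : Ω) (i : Fin n) (j : Fin m) :
    assignment (R.π t ω) i j
      = ∑ ρ, Set.indicator {ω | R.π t ω = ρ} (fun _ => (1 : ℝ)) ω * assignment ρ i j := by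
  rw [Finset.sum_eq_single (R.π t ω)]
  · simp
  · intro ρ _ hρ
    simp [Set.indicator, hρ.symm]
  · simp

lemma measurable_assignment (R : Run φ B V η ε q μ) {t : ℕ} (ht : 1 ≤ t) (i : Fin n) (j : Fin m) :
    Measurable fun ω => assignment (R.π t ω) i j := by
  simp only [R.assignment_eq_sum t]
  refine Finset.measurable_sum _ fun ρ _ => Measurable.mul_const ?_ _
  exact measurable_const.indicator (R.ℱ.le _ _ (R.measurable_π t ht ρ))

/-- Given the past, link `(i,j)` is assigned and successful with probability `P_{i,j} q_{i,j}`. -/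
lemma integral_mul_assignment_mul (R : Run φ B V η ε q μ) [IsProbabilityMeasure μ] {t : ℕ}
    (ht : 1 ≤ t) (i : Fin n) (j : Fin m) {Z : Ω → ℝ} (hZ : Measurable[R.ℱ t] Z) {c : ℝ}
    (hc : ∀ ω, |Z ω| ≤ c) :
    ∫ ω, Z ω * (R.S t ω i j * assignment (R.π t ω) i j) ∂μ
      = ∫ ω, Z ω * (q t i j * roundMatrix (R.Pt t ω) (userIdx i) (chanIdx j)) ∂μ := by
  have hle := R.ℱ.le t
  set I : Equiv.Perm (Fin (max n m)) → Ω → ℝ := fun ρ =>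
    Set.indicator {ω | R.π t ω = ρ} (fun _ => (1 : ℝ)) with hI
  have hIset : ∀ ρ, MeasurableSet {ω | R.π t ω = ρ} := fun ρ =>
    R.ℱ.le _ _ (R.measurable_π t ht ρ)
  have hIm : ∀ ρ, Measurable (I ρ) := fun ρ => measurable_const.indicator (hIset ρ)
  have hIb : ∀ ρ ω, |I ρ ω| ≤ 1 := fun ρ ω => by
    simp only [hI, Set.indicator]
    split_ifs <;> simp
  have hZm : Measurable Z := hZ.mono hle le_rfl
  have hIint : ∀ ρ, Integrable (I ρ) μ := fun ρ =>
    Integrable.of_bound (hIm ρ).aestronglyMeasurable 1 (ae_of_all _ fun ω => hIb ρ ω)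
  have hZI : ∀ ρ, Integrable (Z * I ρ) μ := fun ρ =>
    (hIint ρ).bdd_mul hZm.aestronglyMeasurable (ae_of_all _ hc)
  have hSm := R.success.measurable_apply ht i j
  have hSb : ∀ ω, |R.S t ω i j| ≤ 1 := fun ω => by
    rcases R.success.zero_one t ht ω i j with h | h <;> simp [h]
  -- Condition on `ℱ t` and pull out the bounded factor `Z`.
  have hpull : ∀ ρ, ∫ ω, (Z * I ρ) ω ∂μ = ∫ ω, Z ω * R.w t ω ρ ∂μ := by
    intro ρ
    rw [← integral_condExp hle]
    refine integral_congr_ae ?_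
    filter_upwards [condExp_stronglyMeasurable_mul_of_bound hle hZ.stronglyMeasurable (hIint ρ) c
      (ae_of_all _ hc), R.sample t ht ρ] with ω h1 h2
    rw [h1, Pi.mul_apply, h2]
  -- The successes of the slot are independent of the past and the sampled permutation jointly.
  have hindep : ∀ ρ, ∫ ω, (Z * I ρ) ω * R.S t ω i j ∂μ = (∫ ω, (Z * I ρ) ω ∂μ) * q t i j := by
    intro ρ
    rw [← R.success.integral_eq ht i j]
    refine IndepFun.integral_fun_mul_eq_mul_integral ?_ (hZI ρ).aestronglyMeasurable
      hSm.aestronglyMeasurable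
    have h1 : Measurable[R.ℱ t ⊔ MeasurableSpace.comap (R.π t) ⊤] (Z * I ρ) := by
      refine Measurable.mul (hZ.mono le_sup_left le_rfl) ?_
      refine Measurable.mono (ma := MeasurableSpace.comap (R.π t) ⊤) ?_ le_sup_right le_rfl
      exact Measurable.indicator measurable_const ⟨{ρ}, trivial, rfl⟩
    have h2 : Measurable[MeasurableSpace.comap (R.S t) inferInstance] fun ω => R.S t ω i j :=
      (measurable_pi_apply j).comp ((measurable_pi_apply i).comp (comap_measurable (R.S t)))
    exact indep_of_indep_of_le_left (indep_of_indep_of_le_right (R.fresh t ht).symm h2.comap_le)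
      h1.comap_le
  have hZIS : ∀ ρ, Integrable (fun ω => (Z * I ρ) ω * R.S t ω i j) μ := fun ρ =>
    (hZI ρ).mul_bdd hSm.aestronglyMeasurable (ae_of_all _ hSb)
  have hwm : ∀ ρ, Measurable fun ω => R.w t ω ρ := fun ρ =>
    (R.measurable_w t ht ρ).mono hle le_rfl
  have hw1 : ∀ ρ ω, |R.w t ω ρ| ≤ 1 := fun ρ ω => by
    rw [abs_of_nonneg (R.w_nonneg t ht ω ρ), ← R.w_sum t ht ω]
    exact Finset.single_le_sum (fun ρ _ => R.w_nonneg t ht ω ρ) (Finset.mem_univ ρ)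
  have hZw : ∀ ρ, Integrable (fun ω => Z ω * R.w t ω ρ) μ := fun ρ =>
    (Integrable.of_bound hZm.aestronglyMeasurable c (ae_of_all _ hc)).mul_bdd
      (hwm ρ).aestronglyMeasurable (ae_of_all _ (hw1 ρ))
  calc ∫ ω, Z ω * (R.S t ω i j * assignment (R.π t ω) i j) ∂μ
      = ∫ ω, ∑ ρ, assignment ρ i j * ((Z * I ρ) ω * R.S t ω i j) ∂μ := by
        refine integral_congr_ae (ae_of_all _ fun ω => ?_)
        simp only [R.assignment_eq_sum t ω i j, Finset.mul_sum, Pi.mul_apply, hI]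
        exact Finset.sum_congr rfl fun ρ _ => by ring
    _ = ∑ ρ, assignment ρ i j * ((∫ ω, Z ω * R.w t ω ρ ∂μ) * q t i j) := by
        rw [integral_finsetSum _ fun ρ _ => (hZIS ρ).const_mul _]
        simp only [integral_const_mul, hindep, hpull]
    _ = ∫ ω, ∑ ρ, assignment ρ i j * (Z ω * R.w t ω ρ * q t i j) ∂μ := by
        rw [integral_finsetSum _ fun ρ _ => ((hZw ρ).mul_const _).const_mul _]
        simp only [integral_const_mul, integral_mul_const]
    _ = _ := by
        refine integral_congr_ae (ae_of_all _ fun ω => ?_)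
        simp only
        rw [R.w_decomp t ht ω, Matrix.sum_apply]
        simp only [Finset.mul_sum, Matrix.smul_apply, smul_eq_mul, assignment]
        exact Finset.sum_congr rfl fun ρ _ => by ring

end Run

/-! ### The comparator -/

/-- Every doubly substochastic `n × m` matrix is, up to a factor `1 - ε s`, dominated by the upper
left block of a doubly stochastic matrix with entries at least `ε`. -/
lemma exists_doublyStochastic_ge {n m : ℕ} {ε : ℝ} (hε : 0 < ε)
    (hεs : ε * (max n m : ℕ) ≤ 1) (A : Fin n → Fin m → ℝ)
    (hA : ∀ i j, 0 ≤ A i j) (hr : ∀ i, ∑ j, A i j ≤ 1) (hc : ∀ j, ∑ i, A i j ≤ 1) :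
    ∃ W ∈ doublyStochastic (max n m) ε,
      ∀ i j, (1 - ε * (max n m : ℕ)) * A i j ≤ W (userIdx i) (chanIdx j) := by
  classical
  -- `A` padded by zeros to size `s`; `fillUp` then completes it to a doubly stochastic matrix above
  -- it.
  set P : Matrix (Fin (max n m)) (Fin (max n m)) ℝ := fun k l =>
    ∑ i, ∑ j, if userIdx i = k ∧ chanIdx j = l then A i j else 0 with hP
  have hP0 : ∀ k l, 0 ≤ P k l := fun k l =>
    Finset.sum_nonneg fun i _ => Finset.sum_nonneg fun j _ => by
      split_ifs
      exacts [hA i j, le_rfl]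
  have hPA : ∀ i j, P (userIdx i) (chanIdx j) = A i j := by
    intro i j
    simp only [hP]
    rw [Finset.sum_eq_single i, Finset.sum_eq_single j]
    · simp
    · intro l _ hl
      simp [chanIdx_injective.ne hl]
    · simp
    · intro k _ hk
      simp [userIdx_injective.ne hk]
    · simp
  have hcard : ∀ {α β : Type} [Fintype α] [DecidableEq β] (e : α → β), Function.Injective e →
      ∀ b, ∑ a, (if e a = b then (1 : ℝ) else 0) ≤ 1 := by
    intro α β _ _ e he b
    rw [Finset.sum_boole]
    have : (Finset.univ.filter fun a => e a = b).card ≤ 1 :=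
      Finset.card_le_one.2 fun a ha a' ha' => he (by
        rw [(Finset.mem_filter.1 ha).2, (Finset.mem_filter.1 ha').2])
    exact_mod_cast this
  have hPr : ∀ k, ∑ l, P k l ≤ 1 := by
    intro k
    refine le_trans ?_ (hcard (userIdx (n := n) (m := m)) userIdx_injective k)
    simp only [hP]
    rw [Finset.sum_comm]
    refine Finset.sum_le_sum fun i _ => ?_
    rw [Finset.sum_comm]
    by_cases h : userIdx i = k
    · simpa [h] using hr i
    · simp [h]
  have hPc : ∀ l, ∑ k, P k l ≤ 1 := by
    intro l
    refine le_trans ?_ (hcard (chanIdx (n := n) (m := m)) chanIdx_injective l)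
    simp only [hP]
    have e : ∀ k : Fin (max n m), ∑ i : Fin n, ∑ j : Fin m,
        (if userIdx i = k ∧ chanIdx j = l then A i j else 0)
        = ∑ j : Fin m, ∑ i : Fin n, (if userIdx i = k ∧ chanIdx j = l then A i j else 0) :=
      fun k => Finset.sum_comm
    simp only [e]
    rw [Finset.sum_comm]
    refine Finset.sum_le_sum fun j _ => ?_
    rw [Finset.sum_comm]
    by_cases h : chanIdx j = l
    · simpa [h] using hc j
    · simp [h]
  obtain ⟨hF1, hF2, hF3⟩ := fillUp_spec hPr hPc
  set F := fillUp P
  have h0 : 0 ≤ 1 - ε * (max n m : ℕ) := by linarith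
  have hF0 : ∀ k l, 0 ≤ (1 - ε * (max n m : ℕ)) * F k l := fun k l =>
    mul_nonneg h0 ((hP0 k l).trans (hF1 k l))
  -- Mixture with the uniform matrix, whose entries are `1/s`, at weight `εs`.
  set W : Matrix (Fin (max n m)) (Fin (max n m)) ℝ :=
    fun k l => (1 - ε * (max n m : ℕ)) * F k l + ε with hW
  have hWε : ∀ k l, ε ≤ W k l := fun k l => by
    simp only [hW]
    linarith [hF0 k l]
  refine ⟨W, ⟨⟨fun k l => hε.le.trans (hWε k l), fun l => ?_, hWε⟩,
    ⟨fun k l => hε.le.trans (hWε k l), fun k => ?_, hWε⟩⟩, fun i j => ?_⟩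
  · simp only [hW, Finset.sum_add_distrib, ← Finset.mul_sum, hF3, Finset.sum_const,
      Finset.card_univ, Fintype.card_fin, nsmul_eq_mul]
    ring
  · simp only [hW, Finset.sum_add_distrib, ← Finset.mul_sum, hF2, Finset.sum_const,
      Finset.card_univ, Fintype.card_fin, nsmul_eq_mul]
    ring
  · have := mul_le_mul_of_nonneg_left (hF1 (userIdx i) (chanIdx j)) h0
    rw [hPA] at this
    simp only [hW]
    linarith

lemma sum_mul_mem_cube {n m : ℕ} {A p : Fin n → Fin m → ℝ}
    (hA : ∀ i j, 0 ≤ A i j) (hr : ∀ i, ∑ j, A i j ≤ 1)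
    (hp : ∀ i j, 0 ≤ p i j ∧ p i j ≤ 1) : (fun i => ∑ j, A i j * p i j) ∈ cube n := fun i =>
  ⟨Finset.sum_nonneg fun j _ => mul_nonneg (hA i j) (hp i j).1,
    (Finset.sum_le_sum fun j _ => mul_le_of_le_one_right (hA i j) (hp i j).2).trans (hr i)⟩

namespace Run

variable {n m : ℕ} {φ : (Fin n → ℝ) → ℝ} {B V η ε : ℝ} {q : ℕ → Fin n → Fin m → ℝ}
  {Ω : Type u} [mΩ : MeasurableSpace Ω] {μ : Measure Ω}

/-! ### The Lyapunov function -/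

/-- The sum of the queue drift function and of the scaled divergence from a comparator `W`. -/
noncomputable def potential (R : Run φ B V η ε q μ)
    (W : Matrix (Fin (max n m)) (Fin (max n m)) ℝ) (t : ℕ) (ω : Ω) : ℝ :=
  1 / 2 * ∑ i, R.Q t ω i ^ 2 + 1 / η * divergence W (R.Pt t ω)

lemma potential_nonneg (R : Run φ B V η ε q μ) (hη : 0 < η) (hε : 0 < ε)
    {W : Matrix (Fin (max n m)) (Fin (max n m)) ℝ} (hW : W ∈ doublyStochastic (max n m) ε) {t : ℕ}
    (ht : 1 ≤ t) (ω : Ω) : 0 ≤ R.potential W t ω := by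
  have := divergence_nonneg (fun i j => hε.trans_le (hW.1.2.2 i j))
    (fun i j => hε.trans_le (R.le_Pt ht ω i j))
    ((sum_of_mem_rowStochastic hW.2).trans (R.sum_Pt ht ω).symm)
  unfold potential
  positivity

/-- `W` has mass `s` and entries at most `1`, and the iterates have entries at least `ε`, so each
logarithm is at most `log (1/ε)`. The bound is uniform in time, which allows windows to start
anywhere. -/
lemma potential_le (R : Run φ B V η ε q μ) (hφ : IsUtility φ B) (hn : 0 < n) (hV : 0 < V)
    (hη : 0 < η) (hε : 0 < ε)
    {W : Matrix (Fin (max n m)) (Fin (max n m)) ℝ} (hW : W ∈ doublyStochastic (max n m) ε) {t : ℕ}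
    (ht : 1 ≤ t) (ω : Ω) :
    R.potential W t ω ≤ 1 / 2 * (n * (B * V + 1) ^ 2)
      + 1 / η * ((max n m : ℕ) * Real.log (1 / ε)) := by
  have h1 : ∑ i, R.Q t ω i ^ 2 ≤ n * (B * V + 1) ^ 2 := by
    have : ∑ i, R.Q t ω i ^ 2 ≤ ∑ _i : Fin n, (B * V + 1) ^ 2 := Finset.sum_le_sum fun i _ => by
      have := R.Q_mem hφ hn hV ht ω i
      exact pow_le_pow_left₀ this.1 this.2 2
    simpa using this
  have h2 : divergence W (R.Pt t ω) ≤ (max n m : ℕ) * Real.log (1 / ε) := by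
    rw [← sum_of_mem_rowStochastic hW.2, divergence, Finset.sum_mul]
    refine Finset.sum_le_sum fun i _ => ?_
    rw [Finset.sum_mul]
    refine Finset.sum_le_sum fun j _ => ?_
    have hP := hε.trans_le (R.le_Pt ht ω i j)
    have hWp := hε.trans_le (hW.1.2.2 i j)
    refine mul_le_mul_of_nonneg_left ?_ hWp.le
    refine Real.log_le_log (by positivity) ?_
    exact div_le_div₀ zero_le_one (le_one_of_mem_rowStochastic hW.2 i j) hε (R.le_Pt ht ω i j)
  unfold potential
  gcongr

lemma integrable_potential (R : Run φ B V η ε q μ) [IsProbabilityMeasure μ] (hφ : IsUtility φ B)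
    (hn : 0 < n) (hV : 0 < V) (hη : 0 < η) (hε : 0 < ε)
    {W : Matrix (Fin (max n m)) (Fin (max n m)) ℝ} (hW : W ∈ doublyStochastic (max n m) ε) {t : ℕ}
    (ht : 1 ≤ t) : Integrable (R.potential W t) μ := by
  have hle := R.ℱ.le t
  have hm : Measurable (R.potential W t) := by
    unfold potential divergence
    refine Measurable.add (Measurable.const_mul ?_ _) (Measurable.const_mul ?_ _)
    · exact Finset.measurable_sum _ fun i _ =>
        ((R.measurable_Q t ht i).mono hle le_rfl).pow_const 2
    · exact Finset.measurable_sum _ fun i _ => Finset.measurable_sum _ fun j _ =>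
        (Real.measurable_log.comp
          (((R.measurable_Pt t ht i j).mono hle le_rfl).const_div _)).const_mul _
  refine Integrable.of_bound hm.aestronglyMeasurable (1 / 2 * (n * (B * V + 1) ^ 2)
    + 1 / η * ((max n m : ℕ) * Real.log (1 / ε))) (ae_of_all _ fun ω => ?_)
  rw [Real.norm_of_nonneg (R.potential_nonneg hη hε hW ht ω)]
  exact R.potential_le hφ hn hV hη hε hW ht ω

/-- The drift inequality along a path. The last sum has mean zero. -/
lemma drift_step (R : Run φ B V η ε q μ) [IsProbabilityMeasure μ] (hφ : IsUtility φ B)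
    (hn : 0 < n) (hV : 0 < V) (hη : 0 < η) (hε : 0 < ε) {A : Fin n → Fin m → ℝ}
    (hA : ∀ i j, 0 ≤ A i j) (hr : ∀ i, ∑ j, A i j ≤ 1)
    {W : Matrix (Fin (max n m)) (Fin (max n m)) ℝ} (hW : W ∈ doublyStochastic (max n m) ε)
    (hAW : ∀ i j, (1 - ε * (max n m : ℕ)) * A i j ≤ W (userIdx i) (chanIdx j)) {t : ℕ}
    (ht : 1 ≤ t) {x g : Fin n → ℝ} (hg : ∀ y ∈ cube n, φ y ≤ φ x + ∑ i, g i * (y i - x i)) (ω : Ω) :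
    V * φ (fun i => ∑ j, A i j * q t i j) ≤ V * φ x + n / 2
      + ε * n * m * (max n m : ℕ) * (B * V + 1) + 2 * (max n m : ℕ) * η * (B * V + 1) ^ 2
      + V * ∑ i, g i * (R.γ (t + 1) ω i - x i)
      + (R.potential W t ω - R.potential W (t + 1) ω)
      + 2 * (max n m : ℕ) * η * ∑ i, ∑ j,
          (R.Q t ω i / roundMatrix (R.Pt t ω) (userIdx i) (chanIdx j)) ^ 2
            * (R.S t ω i j * assignment (R.π t ω) i j)
      + ∑ i, ∑ j, (R.Q t ω i + R.Q t ω i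
            / roundMatrix (R.Pt t ω) (userIdx i) (chanIdx j)
            * (W (userIdx i) (chanIdx j) - R.Pt t ω (userIdx i) (chanIdx j)))
          * (q t i j * roundMatrix (R.Pt t ω) (userIdx i) (chanIdx j)
            - R.S t ω i j * assignment (R.π t ω) i j) := by
  set s : ℝ := ((max n m : ℕ) : ℝ) with hs
  have hs1 : 1 ≤ s := by
    rw [hs]
    exact_mod_cast hn.trans_le (le_max_left n m)
  set K := B * V + 1 with hK
  have hK0 : 0 ≤ K := by
    have := hφ.nonneg hn
    positivity
  set Q := R.Q t ω with hQdef
  have hQ : ∀ i, 0 ≤ Q i ∧ Q i ≤ K := R.Q_mem hφ hn hV ht ω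
  set γ := R.γ (t + 1) ω with hγdef
  set X := successes (assignment (R.π t ω)) (R.S t ω) with hXdef
  set P := roundMatrix (R.Pt t ω) with hPdef
  set SY : Fin n → Fin m → ℝ := fun i j => R.S t ω i j * assignment (R.π t ω) i j with hSY
  -- Squares of zero-one values collapse, so the squared estimator is linear in `SY` and one factor
  -- `1 / P` cancels in expectation.
  have hSY01 : ∀ i j, SY i j ^ 2 = SY i j := fun i j => by
    rcases R.success.zero_one t ht ω i j with h | h <;>
      rcases assignment_zero_one (R.π t ω) i j with h' | h' <;> simp [hSY, h, h']
  have hP : ∀ i j, 0 < P i j := fun i j =>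
    lt_of_lt_of_le (by positivity) ((R.roundMatrix_spec hε ht ω).1 i j)
  have hX : ∀ i, X i = ∑ j, SY i j := fun i =>
    Finset.sum_congr rfl fun j _ => mul_comm _ _
  have hX01 : ∀ i, 0 ≤ X i ∧ X i ≤ 1 := fun i =>
    successes_mem_Icc (assignment_zero_one (R.π t ω)) (R.success.zero_one t ht ω)
      (sum_assignment_le (R.π t ω)) i
  have hq : ∀ i j, 0 ≤ q t i j ∧ q t i j ≤ 1 := fun i j =>
    ⟨R.success.nonneg ht i j, R.success.le_one ht i j⟩
  have hγ : γ ∈ cube n := R.γ_mem t ht ω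
  have hmin := R.γ_min t ht ω (sum_mul_mem_cube hA hr hq)
  simp only [Set.mem_ofPred_eq] at hmin
  rw [← hQdef, ← hγdef] at hmin
  have hsub : V * φ γ ≤ V * (φ x + ∑ i, g i * (γ i - x i)) :=
    mul_le_mul_of_nonneg_left (hg γ hγ) hV.le
  -- Expand the square; `|γ_i - X_i| ≤ 1` costs one half per user.
  have hdrift : 1 / 2 * ∑ i, R.Q (t + 1) ω i ^ 2 ≤ 1 / 2 * ∑ i, Q i ^ 2 + n / 2
      + (∑ i, Q i * γ i - ∑ i, Q i * X i) := by
    have : ∑ i, R.Q (t + 1) ω i ^ 2 ≤ ∑ i, (Q i ^ 2 + 1 + 2 * (Q i * γ i - Q i * X i)) :=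
      Finset.sum_le_sum fun i _ => by
        rw [R.Q_update t ht ω i]
        have h1 : max (Q i + γ i - X i) 0 ^ 2 ≤ (Q i + γ i - X i) ^ 2 := by
          rcases max_cases (Q i + γ i - X i) 0 with ⟨e, -⟩ | ⟨e, -⟩ <;> rw [e]
          simpa using sq_nonneg _
        have h2 : (γ i - X i) ^ 2 ≤ 1 := by
          rw [sq_le_one_iff_abs_le_one, abs_le]
          constructor <;> linarith [(hγ i).1, (hγ i).2, (hX01 i).1, (hX01 i).2]
        refine h1.trans ?_
        nlinarith
    simp only [Finset.sum_add_distrib, ← Finset.mul_sum, Finset.sum_sub_distrib, Finset.sum_const,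
      Finset.card_univ, Fintype.card_fin, nsmul_eq_mul, mul_one] at this
    linarith
  -- Replacing `A` by `W` loses at most `εsK` in each of the `nm` entries.
  have hcomp : ∑ i, Q i * ∑ j, A i j * q t i j
      ≤ ∑ i, ∑ j, Q i * q t i j * W (userIdx i) (chanIdx j) + ε * n * m * s * K := by
    have : ∑ i, Q i * ∑ j, A i j * q t i j
        ≤ ∑ i : Fin n, ∑ j : Fin m, (Q i * q t i j * W (userIdx i) (chanIdx j) + ε * s * K) := by
      refine Finset.sum_le_sum fun i _ => ?_
      rw [Finset.mul_sum]
      refine Finset.sum_le_sum fun j _ => ?_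
      have hA1 : A i j ≤ 1 :=
        (Finset.single_le_sum (fun j _ => hA i j) (Finset.mem_univ j)).trans (hr i)
      have h1 := mul_le_mul_of_nonneg_left (hAW i j) (mul_nonneg (hQ i).1 (hq i j).1)
      have h2 : Q i * q t i j * A i j ≤ K :=
        (mul_le_of_le_one_right (mul_nonneg (hQ i).1 (hq i j).1) hA1).trans
          ((mul_le_of_le_one_right (hQ i).1 (hq i j).2).trans (hQ i).2)
      have h3 := mul_le_mul_of_nonneg_left h2 (show 0 ≤ ε * s by positivity)
      nlinarith
    refine this.trans (le_of_eq ?_)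
    simp only [Finset.sum_add_distrib, Finset.sum_const, Finset.card_univ, Fintype.card_fin,
      nsmul_eq_mul]
    ring
  have hreg := R.regret_step hφ hn hV hη hε hW ht ω
    (fun i j => Q i * estimator P (assignment (R.π t ω)) (R.S t ω) i j) (fun i j => rfl)
  have hG2 : ∑ i, ∑ j, (Q i * estimator P (assignment (R.π t ω)) (R.S t ω) i j) ^ 2
      = ∑ i, ∑ j, (Q i / P (userIdx i) (chanIdx j)) ^ 2 * SY i j :=
    Finset.sum_congr rfl fun i _ => Finset.sum_congr rfl fun j _ => by
      rw [← hSY01 i j]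
      simp only [estimator, hSY]
      ring
  -- Collects both substitutions of a conditional mean: `X` by its mean and the estimator by `q`.
  -- Each is a past-measurable multiple of `qP - SY`.
  have hzero : ∑ i, ∑ j, (Q i + Q i / P (userIdx i) (chanIdx j)
            * (W (userIdx i) (chanIdx j) - R.Pt t ω (userIdx i) (chanIdx j)))
          * (q t i j * P (userIdx i) (chanIdx j) - SY i j)
      = ∑ i, ∑ j, Q i * q t i j * W (userIdx i) (chanIdx j) - ∑ i, Q i * X i
        - ∑ i, ∑ j, Q i * estimator P (assignment (R.π t ω)) (R.S t ω) i j
            * (W (userIdx i) (chanIdx j) - R.Pt t ω (userIdx i) (chanIdx j))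
        - ∑ i, ∑ j, Q i * (q t i j * (R.Pt t ω (userIdx i) (chanIdx j)
            - P (userIdx i) (chanIdx j))) := by
    simp only [hX, Finset.mul_sum, ← Finset.sum_sub_distrib]
    refine Finset.sum_congr rfl fun i _ => Finset.sum_congr rfl fun j _ => ?_
    have := (hP (userIdx i) (chanIdx j)).ne'
    simp only [estimator, hSY]
    field_simp
    ring
  rw [hG2] at hreg
  rw [hzero]
  simp only [potential]
  rw [← hQdef]
  have e : s * η * (2 * ∑ i, ∑ j, (Q i / P (userIdx i) (chanIdx j)) ^ 2 * SY i j + 2 * K ^ 2)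
      = 2 * s * η * ∑ i, ∑ j, (Q i / P (userIdx i) (chanIdx j)) ^ 2 * SY i j
        + 2 * s * η * K ^ 2 := by ring
  rw [e] at hreg
  have e2 : 1 / η * (divergence W (R.Pt t ω) - divergence W (R.Pt (t + 1) ω))
      = 1 / η * divergence W (R.Pt t ω) - 1 / η * divergence W (R.Pt (t + 1) ω) := by ring
  rw [e2] at hreg
  have hmin' : V * φ (fun i => ∑ j, A i j * q t i j) + ∑ i, Q i * γ i
      ≤ V * φ γ + ∑ i, Q i * ∑ j, A i j * q t i j := by linarith
  linarith

lemma roundMatrix_le_one (R : Run φ B V η ε q μ) {t : ℕ} (ht : 1 ≤ t) (ω : Ω)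
    (i j : Fin (max n m)) : roundMatrix (R.Pt t ω) i j ≤ 1 := by
  rw [R.w_decomp t ht ω, Matrix.sum_apply, ← R.w_sum t ht ω]
  refine Finset.sum_le_sum fun ρ _ => ?_
  rw [Matrix.smul_apply, smul_eq_mul, permMatrix_eq_ite]
  refine mul_le_of_le_one_right (R.w_nonneg t ht ω ρ) ?_
  split_ifs <;> simp

lemma integrable_mul_success (R : Run φ B V η ε q μ) [IsProbabilityMeasure μ] {t : ℕ}
    (ht : 1 ≤ t) (i : Fin n) (j : Fin m) {Z : Ω → ℝ} (hZ : Measurable[R.ℱ t] Z) {c : ℝ}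
    (hc : ∀ ω, |Z ω| ≤ c) :
    Integrable (fun ω => Z ω * (R.S t ω i j * assignment (R.π t ω) i j)) μ := by
  have hZi : Integrable Z μ :=
    Integrable.of_bound (hZ.mono (R.ℱ.le t) le_rfl).aestronglyMeasurable c (ae_of_all _ hc)
  refine hZi.mul_bdd (c := 1) (((R.success.measurable_apply ht i j).mul
    (R.measurable_assignment ht i j)).aestronglyMeasurable) (ae_of_all _ fun ω => ?_)
  rcases R.success.zero_one t ht ω i j with h | h <;>
    rcases assignment_zero_one (R.π t ω) i j with h' | h' <;> simp [h, h']

lemma integrable_mul_roundMatrix (R : Run φ B V η ε q μ) [IsProbabilityMeasure μ] (hn : 0 < n)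
    (hε : 0 < ε) {t : ℕ}
    (ht : 1 ≤ t) (i : Fin n) (j : Fin m) {Z : Ω → ℝ} (hZ : Measurable[R.ℱ t] Z) {c : ℝ}
    (hc : ∀ ω, |Z ω| ≤ c) :
    Integrable (fun ω => Z ω *
      (q t i j * roundMatrix (R.Pt t ω) (userIdx i) (chanIdx j))) μ := by
  have hZi : Integrable Z μ :=
    Integrable.of_bound (hZ.mono (R.ℱ.le t) le_rfl).aestronglyMeasurable c (ae_of_all _ hc)
  refine hZi.mul_bdd (c := 1) (Measurable.aestronglyMeasurable
    (((R.measurable_roundMatrix ht _ _).mono (R.ℱ.le t) le_rfl).const_mul _))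
    (ae_of_all _ fun ω => ?_)
  have hP : 0 ≤ roundMatrix (R.Pt t ω) (userIdx i) (chanIdx j) :=
    le_trans (by positivity) ((R.roundMatrix_spec hε ht ω).1 (userIdx i) (chanIdx j))
  rw [Real.norm_of_nonneg (mul_nonneg (R.success.nonneg ht i j) hP)]
  exact mul_le_one₀ (R.success.le_one ht i j) hP (R.roundMatrix_le_one ht ω _ _)

lemma integrable_γ (R : Run φ B V η ε q μ) [IsProbabilityMeasure μ] {t : ℕ} (ht : 1 ≤ t)
    (i : Fin n) : Integrable (fun ω => R.γ (t + 1) ω i) μ := by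
  refine Integrable.of_bound
    ((R.measurable_γ t ht i).mono (R.ℱ.le _) le_rfl).aestronglyMeasurable 1
    (ae_of_all _ fun ω => ?_)
  have := R.γ_mem t ht ω i
  rw [Real.norm_of_nonneg this.1]
  exact this.2

/-- The drift inequality in expectation. -/
lemma integral_drift_step (R : Run φ B V η ε q μ) [IsProbabilityMeasure μ] (hφ : IsUtility φ B)
    (hn : 0 < n) (hm : 0 < m) (hV : 0 < V) (hη : 0 < η) (hε : 0 < ε)
    (hεs : ε * (max n m : ℕ) ≤ 1) {A : Fin n → Fin m → ℝ}
    (hA : ∀ i j, 0 ≤ A i j) (hr : ∀ i, ∑ j, A i j ≤ 1)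
    {W : Matrix (Fin (max n m)) (Fin (max n m)) ℝ} (hW : W ∈ doublyStochastic (max n m) ε)
    (hAW : ∀ i j, (1 - ε * (max n m : ℕ)) * A i j ≤ W (userIdx i) (chanIdx j)) {t : ℕ}
    (ht : 1 ≤ t) {x g : Fin n → ℝ} (hg : ∀ y ∈ cube n, φ y ≤ φ x + ∑ i, g i * (y i - x i)) :
    V * φ (fun i => ∑ j, A i j * q t i j) ≤ V * φ x + n / 2
      + ε * n * m * (max n m : ℕ) * (B * V + 1)
      + 9 * η * n * m * ((max n m : ℕ) : ℝ) ^ 2 / (2 * ε) * (B * V + 1) ^ 2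
      + V * ∑ i, g i * (∫ ω, R.γ (t + 1) ω i ∂μ - x i)
      + (∫ ω, R.potential W t ω ∂μ - ∫ ω, R.potential W (t + 1) ω ∂μ) := by
  set s : ℝ := ((max n m : ℕ) : ℝ) with hs
  have hs1 : 1 ≤ s := by
    rw [hs]
    exact_mod_cast hn.trans_le (le_max_left n m)
  set K := B * V + 1 with hK
  have hK0 : 0 ≤ K := by
    have := hφ.nonneg hn
    positivity
  set P : Ω → Fin n → Fin m → ℝ := fun ω i j =>
    roundMatrix (R.Pt t ω) (userIdx i) (chanIdx j) with hP
  set SY : Ω → Fin n → Fin m → ℝ := fun ω i j => R.S t ω i j * assignment (R.π t ω) i j with hSY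
  have hPε : ∀ ω i j, ε / s ≤ P ω i j := fun ω i j => (R.roundMatrix_spec hε ht ω).1 _ _
  have hP0 : ∀ ω i j, 0 < P ω i j := fun ω i j => lt_of_lt_of_le (by positivity) (hPε ω i j)
  have hPinv : ∀ ω i j, 1 / P ω i j ≤ s / ε := fun ω i j => by
    rw [← one_div_div ε s]
    exact one_div_le_one_div_of_le (by positivity) (hPε ω i j)
  have hPm : ∀ i j, Measurable[R.ℱ t] fun ω => P ω i j := fun i j => R.measurable_roundMatrix ht _ _
  have hQ : ∀ ω i, 0 ≤ R.Q t ω i ∧ R.Q t ω i ≤ K := R.Q_mem hφ hn hV ht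
  have hQm := R.measurable_Q t ht
  have hQP : ∀ ω i j, 0 ≤ R.Q t ω i / P ω i j ∧ R.Q t ω i / P ω i j ≤ K * (s / ε) := fun ω i j =>
    ⟨div_nonneg (hQ ω i).1 (hP0 ω i j).le, by
      rw [div_eq_mul_one_div]
      exact mul_le_mul (hQ ω i).2 (hPinv ω i j) (one_div_nonneg.2 (hP0 ω i j).le) hK0⟩
  set Z₁ : Fin n → Fin m → Ω → ℝ := fun i j ω => (R.Q t ω i / P ω i j) ^ 2 with hZ₁
  set Z₂ : Fin n → Fin m → Ω → ℝ := fun i j ω => R.Q t ω i + R.Q t ω i / P ω i j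
      * (W (userIdx i) (chanIdx j) - R.Pt t ω (userIdx i) (chanIdx j)) with hZ₂
  have hZ₁m : ∀ i j, Measurable[R.ℱ t] (Z₁ i j) := fun i j =>
    ((hQm i).div (hPm i j)).pow_const 2
  have hZ₂m : ∀ i j, Measurable[R.ℱ t] (Z₂ i j) := fun i j =>
    (hQm i).add (((hQm i).div (hPm i j)).mul ((R.measurable_Pt t ht _ _).const_sub _))
  have hZ₁b : ∀ i j ω, |Z₁ i j ω| ≤ (K * (s / ε)) ^ 2 := fun i j ω => by
    rw [abs_of_nonneg (sq_nonneg _)]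
    exact pow_le_pow_left₀ (hQP ω i j).1 (hQP ω i j).2 2
  have hZ₂b : ∀ i j ω, |Z₂ i j ω| ≤ K + K * (s / ε) * 1 := fun i j ω => by
    refine (abs_add_le _ _).trans (add_le_add ?_ ?_)
    · rw [abs_of_nonneg (hQ ω i).1]
      exact (hQ ω i).2
    · rw [abs_mul, abs_of_nonneg (hQP ω i j).1]
      refine mul_le_mul (hQP ω i j).2 ?_ (abs_nonneg _) (by positivity)
      rw [abs_le]
      have h1 := hW.1.1 (userIdx i) (chanIdx j)
      have h2 := le_one_of_mem_rowStochastic hW.2 (userIdx i) (chanIdx j)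
      have h3 := hε.le.trans (R.le_Pt ht ω (userIdx i) (chanIdx j))
      have h4 := R.Pt_le_one ht ω (userIdx i) (chanIdx j)
      constructor <;> linarith
  set c₀ := V * φ x + n / 2 + ε * n * m * s * K + 2 * s * η * K ^ 2 with hc₀
  have hIγ : ∀ i, Integrable (fun ω => g i * (R.γ (t + 1) ω i - x i)) μ := fun i =>
    ((R.integrable_γ ht i).sub (integrable_const _)).const_mul _
  have hI1 : Integrable (fun ω => V * ∑ i, g i * (R.γ (t + 1) ω i - x i)) μ :=
    (integrable_finsetSum _ fun i _ => hIγ i).const_mul _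
  have hI2 := R.integrable_potential hφ hn hV hη hε hW ht
  have hI3 := R.integrable_potential hφ hn hV hη hε hW (t := t + 1) (by omega)
  have hI4 : Integrable (fun ω => 2 * s * η * ∑ i, ∑ j, Z₁ i j ω * SY ω i j) μ :=
    (integrable_finsetSum _ fun i _ => integrable_finsetSum _ fun j _ =>
      R.integrable_mul_success ht i j (hZ₁m i j) (hZ₁b i j)).const_mul _
  have hI5 : ∀ i j, Integrable (fun ω => Z₂ i j ω * (q t i j * P ω i j - SY ω i j)) μ :=
    fun i j => by
      simp only [mul_sub]
      exact (R.integrable_mul_roundMatrix hn hε ht i j (hZ₂m i j) (hZ₂b i j)).sub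
        (R.integrable_mul_success ht i j (hZ₂m i j) (hZ₂b i j))
  have hI6 : Integrable (fun ω => ∑ i, ∑ j, Z₂ i j ω * (q t i j * P ω i j - SY ω i j)) μ :=
    integrable_finsetSum _ fun i _ => integrable_finsetSum _ fun j _ => hI5 i j
  have hE1 : ∫ ω, V * ∑ i, g i * (R.γ (t + 1) ω i - x i) ∂μ
      = V * ∑ i, g i * (∫ ω, R.γ (t + 1) ω i ∂μ - x i) := by
    rw [integral_const_mul, integral_finsetSum _ fun i _ => hIγ i]
    congr 1
    refine Finset.sum_congr rfl fun i _ => ?_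
    rw [integral_const_mul, integral_sub (R.integrable_γ ht i) (integrable_const _)]
    simp
  have hE4 : ∫ ω, 2 * s * η * ∑ i, ∑ j, Z₁ i j ω * SY ω i j ∂μ
      ≤ 2 * s * η * (n * m * (K ^ 2 * (s / ε))) := by
    rw [integral_const_mul, integral_finsetSum _ fun i _ => integrable_finsetSum _ fun j _ =>
      R.integrable_mul_success ht i j (hZ₁m i j) (hZ₁b i j)]
    refine mul_le_mul_of_nonneg_left ?_ (by positivity)
    -- Averaging `SY` to `qP` turns `Q² / P²` into `Q² q / P`, and `1 / P ≤ s / ε`.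
    have : ∀ i j, ∫ ω, Z₁ i j ω * SY ω i j ∂μ ≤ K ^ 2 * (s / ε) := by
      intro i j
      rw [R.integral_mul_assignment_mul ht i j (hZ₁m i j) (hZ₁b i j)]
      refine (integral_mono (R.integrable_mul_roundMatrix hn hε ht i j (hZ₁m i j) (hZ₁b i j))
        (integrable_const (K ^ 2 * (s / ε))) fun ω => ?_).trans_eq (by simp)
      have e : Z₁ i j ω * (q t i j * P ω i j) = R.Q t ω i ^ 2 * (q t i j * (1 / P ω i j)) := by
        have := (hP0 ω i j).ne'
        simp only [hZ₁]
        field_simp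
      refine e.trans_le ?_
      refine mul_le_mul (pow_le_pow_left₀ (hQ ω i).1 (hQ ω i).2 2) ?_ ?_ (by positivity)
      · exact (mul_le_of_le_one_left (one_div_nonneg.2 (hP0 ω i j).le)
          (R.success.le_one ht i j)).trans (hPinv ω i j)
      · exact mul_nonneg (R.success.nonneg ht i j) (one_div_nonneg.2 (hP0 ω i j).le)
    calc _ ≤ ∑ _i : Fin n, ∑ _j : Fin m, K ^ 2 * (s / ε) := by
          refine Finset.sum_le_sum fun i _ => ?_
          rw [integral_finsetSum _ fun j _ =>
            R.integrable_mul_success ht i j (hZ₁m i j) (hZ₁b i j)]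
          exact Finset.sum_le_sum fun j _ => this i j
      _ = _ := by
          simp
          ring
  have hE6 : ∫ ω, ∑ i, ∑ j, Z₂ i j ω * (q t i j * P ω i j - SY ω i j) ∂μ = 0 := by
    rw [integral_finsetSum _ fun i _ => integrable_finsetSum _ fun j _ => hI5 i j]
    refine Finset.sum_eq_zero fun i _ => ?_
    rw [integral_finsetSum _ fun j _ => hI5 i j]
    refine Finset.sum_eq_zero fun j _ => ?_
    simp only [mul_sub]
    rw [integral_sub (R.integrable_mul_roundMatrix hn hε ht i j (hZ₂m i j) (hZ₂b i j))
        (R.integrable_mul_success ht i j (hZ₂m i j) (hZ₂b i j)),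
      R.integral_mul_assignment_mul ht i j (hZ₂m i j) (hZ₂b i j), sub_self]
  have hmono := integral_mono (μ := μ) (integrable_const _)
    (((((integrable_const c₀).add hI1).add (hI2.sub hI3)).add hI4).add hI6)
    fun ω => R.drift_step hφ hn hV hη hε hA hr hW hAW ht hg ω
  rw [integral_add' ((((integrable_const c₀).add hI1).add (hI2.sub hI3)).add hI4) hI6,
    integral_add' (((integrable_const c₀).add hI1).add (hI2.sub hI3)) hI4,
    integral_add' ((integrable_const c₀).add hI1) (hI2.sub hI3),
    integral_add' (integrable_const c₀) hI1, integral_sub' hI2 hI3, hE1, hE6] at hmono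
  simp only [integral_const, probReal_univ, one_smul, add_zero] at hmono
  -- Since `nms/ε ≥ 1`, the second summand is at most the first; the total `4` is below the stated
  -- `9/2`.
  have hsq : 2 * s * η * (n * m * (K ^ 2 * (s / ε))) + 2 * s * η * K ^ 2
      ≤ 9 * η * n * m * s ^ 2 / (2 * ε) * K ^ 2 := by
    have hsε : 1 ≤ s / ε := by
      rw [le_div_iff₀ hε]
      nlinarith
    have hn1 : (1 : ℝ) ≤ n := by exact_mod_cast hn
    have hm1 : (1 : ℝ) ≤ m := by exact_mod_cast hm
    have h1 : (1 : ℝ) ≤ n * m * (s / ε) := by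
      have := mul_le_mul hn1 hm1 zero_le_one (zero_le_one.trans hn1)
      nlinarith
    have e : 9 * η * n * m * s ^ 2 / (2 * ε) * K ^ 2
        = 9 / 2 * (s * η * K ^ 2) * (n * m * (s / ε)) := by
      field_simp
    have h2 : 0 ≤ s * η * K ^ 2 := by positivity
    rw [e]
    nlinarith [mul_le_mul_of_nonneg_left h1 h2]
  linarith

/-! ### Summation over a window -/

lemma successes_mem (R : Run φ B V η ε q μ) {t : ℕ} (ht : 1 ≤ t) (ω : Ω) (i : Fin n) :
    0 ≤ successes (assignment (R.π t ω)) (R.S t ω) i ∧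
      successes (assignment (R.π t ω)) (R.S t ω) i ≤ 1 :=
  successes_mem_Icc (assignment_zero_one (R.π t ω)) (R.success.zero_one t ht ω)
    (sum_assignment_le (R.π t ω)) i

lemma integrable_successes (R : Run φ B V η ε q μ) [IsProbabilityMeasure μ] {t : ℕ} (ht : 1 ≤ t)
    (i : Fin n) : Integrable (fun ω => successes (assignment (R.π t ω)) (R.S t ω) i) μ := by
  have hm : Measurable fun ω => successes (assignment (R.π t ω)) (R.S t ω) i :=
    Finset.measurable_sum _ fun j _ =>
      (R.measurable_assignment ht i j).mul (R.success.measurable_apply ht i j)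
  refine Integrable.of_bound hm.aestronglyMeasurable 1 (ae_of_all _ fun ω => ?_)
  have := R.successes_mem ht ω i
  rw [Real.norm_of_nonneg this.1]
  exact this.2

lemma mean_eq (R : Run φ B V η ε q μ) [IsProbabilityMeasure μ] {T₀ : ℕ} (hT₀ : 1 ≤ T₀) (T : ℕ)
    (i : Fin n) : R.mean T₀ T i = 1 / (T : ℝ) *
      ∑ k ∈ Finset.range T, ∫ ω, successes (assignment (R.π (T₀ + k) ω)) (R.S (T₀ + k) ω) i ∂μ := by
  simp only [Run.mean, Finset.sum_Ico_eq_sum_range, Nat.add_sub_cancel_left]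
  rw [integral_const_mul, integral_finsetSum _ fun k _ => R.integrable_successes (by omega) i]

lemma average_mem_Icc {f : ℕ → ℝ} (hf : ∀ k, 0 ≤ f k ∧ f k ≤ 1) (T : ℕ) :
    0 ≤ 1 / (T : ℝ) * ∑ k ∈ Finset.range T, f k ∧
      1 / (T : ℝ) * ∑ k ∈ Finset.range T, f k ≤ 1 := by
  refine ⟨mul_nonneg (by positivity) (Finset.sum_nonneg fun k _ => (hf k).1), ?_⟩
  have : ∑ k ∈ Finset.range T, f k ≤ T := by
    simpa using Finset.sum_le_sum fun k (_ : k ∈ Finset.range T) => (hf k).2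
  rw [one_div_mul_eq_div]
  exact div_le_one_of_le₀ this (by positivity)

lemma integral_mem_Icc [IsProbabilityMeasure μ] {f : Ω → ℝ} (hi : Integrable f μ)
    (hf : ∀ ω, 0 ≤ f ω ∧ f ω ≤ 1) : 0 ≤ ∫ ω, f ω ∂μ ∧ ∫ ω, f ω ∂μ ≤ 1 :=
  ⟨integral_nonneg fun ω => (hf ω).1,
    (integral_mono hi (integrable_const 1) fun ω => (hf ω).2).trans_eq (by simp)⟩

lemma mean_mem_cube (R : Run φ B V η ε q μ) [IsProbabilityMeasure μ] {T₀ : ℕ} (hT₀ : 1 ≤ T₀)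
    (T : ℕ) : R.mean T₀ T ∈ cube n := fun i => by
  rw [R.mean_eq hT₀]
  exact average_mem_Icc (fun k => integral_mem_Icc (R.integrable_successes (by omega) i)
    fun ω => R.successes_mem (by omega) ω i) T

/-- The algorithm competes with every doubly substochastic matrix `A`. -/
lemma utility_bound (R : Run φ B V η ε q μ) [IsProbabilityMeasure μ] (hφ : IsUtility φ B)
    (hn : 0 < n) (hm : 0 < m) (hV : 0 < V) (hη : 0 < η) (hε : 0 < ε)
    (hεs : ε * (max n m : ℕ) ≤ 1) {T₀ T : ℕ} (hT₀ : 1 ≤ T₀) (hT : 1 ≤ T)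
    {p : Fin n → Fin m → ℝ} (hq : ∀ t, T₀ ≤ t → t < T₀ + T → q t = p) {A : Fin n → Fin m → ℝ}
    (hA : ∀ i j, 0 ≤ A i j) (hr : ∀ i, ∑ j, A i j ≤ 1) (hc : ∀ j, ∑ i, A i j ≤ 1) :
    φ (fun i => ∑ j, A i j * p i j) - φ (R.mean T₀ T) ≤
      n / V
      + 9 * η * n * m * ((max n m : ℕ) : ℝ) ^ 2 / (2 * ε * V) * (B * V + 1) ^ 2
      + ε * n * m * ((max n m : ℕ) : ℝ) * (B * V + 1) / V
      + ((max n m : ℕ) : ℝ) / (η * V * T) * Real.log (1 / ε)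
      + n * (B * V + 1) ^ 2 / (2 * V * T)
      + n * B * (B * V + 1) / T := by
  obtain ⟨W, hW, hAW⟩ := exists_doublyStochastic_ge hε hεs A hA hr hc
  set s : ℝ := ((max n m : ℕ) : ℝ) with hs
  have hB := hφ.nonneg hn
  set K := B * V + 1 with hK
  have hK0 : 0 ≤ K := by positivity
  have hTr : (0 : ℝ) < T := by exact_mod_cast hT
  set Eγ : ℕ → Fin n → ℝ := fun k i => ∫ ω, R.γ (T₀ + k + 1) ω i ∂μ with hEγ
  set x : Fin n → ℝ := fun i => 1 / (T : ℝ) * ∑ k ∈ Finset.range T, Eγ k i with hx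
  have hxc : x ∈ cube n := fun i => average_mem_Icc (fun k =>
    integral_mem_Icc (R.integrable_γ (by omega) i) fun ω => R.γ_mem _ (by omega) ω i) T
  -- One supergradient at the time average `x` serves all slots; its linear terms sum to zero
  -- (`hz`), which replaces Jensen's inequality.
  obtain ⟨g, hg, -⟩ := hφ.bounded_subgradients x hxc
  set U : ℕ → ℝ := fun k => ∫ ω, R.potential W (T₀ + k) ω ∂μ with hU
  set c := n / 2 + ε * n * m * s * K + 9 * η * n * m * s ^ 2 / (2 * ε) * K ^ 2 with hcdef
  set v := φ (fun i => ∑ j, A i j * p i j) with hv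
  have hstep : ∀ k ∈ Finset.range T,
      V * v ≤ V * φ x + c + V * ∑ i, g i * (Eγ k i - x i) + (U k - U (k + 1)) := by
    intro k hk
    have h := R.integral_drift_step hφ hn hm hV hη hε hεs hA hr hW hAW (t := T₀ + k) (by omega) hg
    rw [hq (T₀ + k) (by omega) (by have := Finset.mem_range.1 hk; omega)] at h
    simp only [hcdef, hU, hEγ]
    rw [← add_assoc T₀ k 1]
    linarith
  have hsum := Finset.sum_le_sum hstep
  have hz : ∑ k ∈ Finset.range T, ∑ i, g i * (Eγ k i - x i) = 0 := by
    rw [Finset.sum_comm]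
    refine Finset.sum_eq_zero fun i _ => ?_
    rw [← Finset.mul_sum, Finset.sum_sub_distrib]
    simp only [hx, Finset.sum_const, Finset.card_range, nsmul_eq_mul]
    field_simp
    ring
  rw [Finset.sum_add_distrib, Finset.sum_add_distrib, Finset.sum_range_sub',
    ← Finset.mul_sum, ← Finset.mul_sum, hz] at hsum
  simp only [Finset.sum_const, Finset.card_range, nsmul_eq_mul, mul_zero, add_zero] at hsum
  have hUT : 0 ≤ U T := integral_nonneg fun ω => R.potential_nonneg hη hε hW (by omega) ω
  have hU0 : U 0 ≤ 1 / 2 * (n * K ^ 2) + 1 / η * (s * Real.log (1 / ε)) := by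
    simp only [hU, add_zero]
    exact (integral_mono (R.integrable_potential hφ hn hV hη hε hW hT₀) (integrable_const _)
      fun ω => R.potential_le hφ hn hV hη hε hW hT₀ ω).trans_eq
        (by rw [integral_const, probReal_univ, one_smul])
  -- The queue update gives `γ_i - X_i ≤ Q_i(t+1) - Q_i(t)`, which telescopes over the window.
  have hxmean : ∀ i, x i - R.mean T₀ T i ≤ K / T := by
    intro i
    rw [R.mean_eq hT₀, ← mul_sub, ← Finset.sum_sub_distrib, one_div_mul_eq_div]
    refine div_le_div_of_nonneg_right ?_ hTr.le
    have e : ∀ k, Eγ k i - ∫ ω, successes (assignment (R.π (T₀ + k) ω)) (R.S (T₀ + k) ω) i ∂μ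
        = ∫ ω, (R.γ (T₀ + k + 1) ω i
          - successes (assignment (R.π (T₀ + k) ω)) (R.S (T₀ + k) ω) i) ∂μ := fun k =>
      (integral_sub (R.integrable_γ (by omega) i) (R.integrable_successes (by omega) i)).symm
    have hI : ∀ k ∈ Finset.range T, Integrable (fun ω => R.γ (T₀ + k + 1) ω i
          - successes (assignment (R.π (T₀ + k) ω)) (R.S (T₀ + k) ω) i) μ := fun k _ =>
      (R.integrable_γ (by omega) i).sub (R.integrable_successes (by omega) i)
    simp only [e]
    rw [← integral_finsetSum _ hI]
    refine (integral_mono (integrable_finsetSum _ hI) (integrable_const K) fun ω => ?_).trans_eq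
      (by simp)
    have h1 : ∀ k ∈ Finset.range T, R.γ (T₀ + k + 1) ω i
          - successes (assignment (R.π (T₀ + k) ω)) (R.S (T₀ + k) ω) i
        ≤ R.Q (T₀ + (k + 1)) ω i - R.Q (T₀ + k) ω i := fun k _ => by
      rw [← add_assoc, R.Q_update (T₀ + k) (by omega) ω i]
      linarith [le_max_left (R.Q (T₀ + k) ω i + R.γ (T₀ + k + 1) ω i
        - successes (assignment (R.π (T₀ + k) ω)) (R.S (T₀ + k) ω) i) 0]
    refine (Finset.sum_le_sum h1).trans ?_
    rw [Finset.sum_range_sub (fun k => R.Q (T₀ + k) ω i)]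
    linarith [(R.Q_mem hφ hn hV (t := T₀ + T) (by omega) ω i).2,
      (R.Q_mem hφ hn hV (t := T₀ + 0) (by omega) ω i).1]
  have hlast := hφ.le_add_of_sub_le hB (R.mean_mem_cube hT₀ T) hxc (by positivity) hxmean
  have hmain : v ≤ φ x
      + (T * c + 1 / 2 * (n * K ^ 2) + 1 / η * (s * Real.log (1 / ε))) / (T * V) := by
    rw [← sub_le_iff_le_add', le_div_iff₀ (by positivity)]
    linarith
  have e : (T * c + 1 / 2 * (n * K ^ 2) + 1 / η * (s * Real.log (1 / ε))) / (T * V)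
      = n / V / 2 + 9 * η * n * m * s ^ 2 / (2 * ε * V) * K ^ 2 + ε * n * m * s * K / V
        + s / (η * V * T) * Real.log (1 / ε) + n * K ^ 2 / (2 * V * T) := by
    simp only [hcdef]
    field_simp
    ring
  have e' : n * B * (K / T) = n * B * K / T := by ring
  -- The drift yields only half of the stated term `n / V`; nonnegativity permits rounding up.
  have hnV : (0 : ℝ) ≤ n / V := by positivity
  rw [e] at hmain
  rw [e'] at hlast
  linarith

end Run

/-! ### The benchmark -/

/-- A probability space with independent links of given success probabilities. -/
lemma exists_isSuccessProcess {n m : ℕ} (p : Fin n → Fin m → ℝ)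
    (hp : ∀ i j, 0 ≤ p i j ∧ p i j ≤ 1) :
    ∃ (Ω : Type) (_ : MeasurableSpace Ω) (μ : Measure Ω) (_ : IsProbabilityMeasure μ)
      (S : ℕ → Ω → Fin n → Fin m → ℝ), IsSuccessProcess μ (fun _ => p) S := by
  set ν : {t : ℕ // 1 ≤ t} × Fin n × Fin m → Measure Bool := fun k =>
    ENNReal.ofReal (p k.2.1 k.2.2) • Measure.dirac true
      + ENNReal.ofReal (1 - p k.2.1 k.2.2) • Measure.dirac false with hν
  have hprob : ∀ k, IsProbabilityMeasure (ν k) := fun k => ⟨by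
    have h := hp k.2.1 k.2.2
    simp only [hν, Measure.add_apply, Measure.smul_apply, measure_univ, smul_eq_mul, mul_one]
    rw [← ENNReal.ofReal_add h.1 (by linarith [h.2])]
    simp⟩
  set S : ℕ → ({t : ℕ // 1 ≤ t} × Fin n × Fin m → Bool) → Fin n → Fin m → ℝ := fun t ω i j =>
    if h : 1 ≤ t then (if ω (⟨t, h⟩, i, j) = true then 1 else 0) else 0 with hS
  have hSe : ∀ (k : {t : ℕ // 1 ≤ t} × Fin n × Fin m) ω,
      S k.1.1 ω k.2.1 k.2.2 = if ω k = true then 1 else 0 := fun k ω => by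
    simp only [hS, k.1.2, dif_pos]
  refine ⟨_, inferInstance, Measure.infinitePi ν, inferInstance, S, ?_, ?_, ?_, ?_⟩
  · intro t ht
    refine measurable_pi_iff.2 fun i => measurable_pi_iff.2 fun j => ?_
    have : (fun ω => S t ω i j) = (fun b : Bool => if b = true then (1 : ℝ) else 0) ∘
        fun ω => ω (⟨t, ht⟩, i, j) := by
      funext ω
      exact hSe (⟨t, ht⟩, i, j) ω
    rw [this]
    exact (measurable_of_finite _).comp (measurable_pi_apply _)
  · intro t ht ω i j
    rw [hSe (⟨t, ht⟩, i, j) ω]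
    split_ifs <;> simp
  · intro t ht i j
    have : {ω | S t ω i j = 1} = (fun ω => ω (⟨t, ht⟩, i, j)) ⁻¹' {true} := by
      ext ω
      simp [hSe (⟨t, ht⟩, i, j) ω]
    rw [this, measureReal_def, ← Measure.map_apply (measurable_pi_apply _) (by measurability),
      Measure.infinitePi_map_eval]
    simp [hν, (hp i j).1]
  · have := iIndepFun_infinitePi (P := ν)
      (X := fun _ (b : Bool) => if b = true then (1 : ℝ) else 0) fun _ => measurable_of_finite _
    simpa only [hSe] using this

/-- No feasible sequence of assignments does better than the best doubly substochastic matrix. -/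
lemma phiOpt_le {n m : ℕ} {φ : (Fin n → ℝ) → ℝ} {B : ℝ} (hφ : IsUtility φ B)
    {p : Fin n → Fin m → ℝ} (hp : ∀ i j, 0 ≤ p i j ∧ p i j ≤ 1) {c : ℝ}
    (h : ∀ A : Fin n → Fin m → ℝ, (∀ i j, 0 ≤ A i j) → (∀ i, ∑ j, A i j ≤ 1) →
      (∀ j, ∑ i, A i j ≤ 1) → φ (fun i => ∑ j, A i j * p i j) ≤ c) : phiOpt φ p ≤ c := by
  refine csSup_le ?_ ?_
  -- The supremum must range over a nonempty set; never assigning anything is feasible.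
  · obtain ⟨Ω, mΩ, μ, hμ, S, hS⟩ := exists_isSuccessProcess p hp
    refine ⟨_, Ω, mΩ, μ, hμ, S, fun _ _ _ _ => 0, ⟨hS, fun _ _ => measurable_const, ?_, ?_, ?_, ?_,
      ?_⟩, rfl⟩
    · exact fun t τ _ _ => indepFun_const_left _ _
    · exact fun t τ _ _ i j => indepFun_const_left _ _
    all_goals simp
  · rintro v ⟨Ω, mΩ, μ, hμ, S, Y, hF, rfl⟩
    set E : ℕ → Fin n → Fin m → ℝ := fun t i j => ∫ ω, Y t ω i j ∂μ with hE
    have hYm : ∀ t, 1 ≤ t → ∀ i j, Measurable fun ω => Y t ω i j := fun t ht i j =>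
      (measurable_pi_apply j).comp ((measurable_pi_apply i).comp (hF.measurable t ht))
    have hYi : ∀ t, 1 ≤ t → ∀ i j, Integrable (fun ω => Y t ω i j) μ := fun t ht i j =>
      Integrable.of_bound (hYm t ht i j).aestronglyMeasurable 1 (ae_of_all _ fun ω => by
        rcases hF.zero_one t ht ω i j with h | h <;> simp [h])
    have hX : ∀ t, 1 ≤ t → ∀ i, ∫ ω, successes (Y t ω) (S t ω) i ∂μ = ∑ j, E t i j * p i j := by
      intro t ht i
      have hi : ∀ j, Integrable (fun ω => Y t ω i j * S t ω i j) μ := fun j =>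
        (hYi t ht i j).mul_bdd (c := 1) (hF.success.measurable_apply ht i j).aestronglyMeasurable
          (ae_of_all _ fun ω => by rcases hF.success.zero_one t ht ω i j with h | h <;> simp [h])
      unfold successes
      rw [integral_finsetSum _ fun j _ => hi j]
      refine Finset.sum_congr rfl fun j _ => ?_
      have hind : IndepFun (fun ω => Y t ω i j) (fun ω => S t ω i j) μ :=
        (hF.indep_future t t ht le_rfl).comp
          ((measurable_pi_apply j).comp (measurable_pi_apply i))
          ((measurable_pi_apply j).comp (measurable_pi_apply i))
      rw [hind.integral_fun_mul_eq_mul_integral (hYm t ht i j).aestronglyMeasurable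
        (hF.success.measurable_apply ht i j).aestronglyMeasurable, hF.success.integral_eq ht i j]
    have hE0 : ∀ t, 1 ≤ t → ∀ i j, 0 ≤ E t i j := fun t ht i j => integral_nonneg fun ω => by
      rcases hF.zero_one t ht ω i j with h | h <;> simp [h]
    have hEr : ∀ t, 1 ≤ t → ∀ i, ∑ j, E t i j ≤ 1 := fun t ht i => by
      rw [← integral_finsetSum _ fun j _ => hYi t ht i j]
      exact (integral_mono (integrable_finsetSum _ fun j _ => hYi t ht i j) (integrable_const 1)
        fun ω => hF.sum_channel_le t ht ω i).trans_eq (by simp)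
    have hEc : ∀ t, 1 ≤ t → ∀ j, ∑ i, E t i j ≤ 1 := fun t ht j => by
      rw [← integral_finsetSum _ fun i _ => hYi t ht i j]
      exact (integral_mono (integrable_finsetSum _ fun i _ => hYi t ht i j) (integrable_const 1)
        fun ω => hF.sum_user_le t ht ω j).trans_eq (by simp)
    -- The time average of the expected assignments is doubly substochastic and yields the average
    -- expected successes. For `T = 0` it is the zero matrix.
    set A : ℕ → Fin n → Fin m → ℝ := fun T i j =>
      1 / (T : ℝ) * ∑ t ∈ Finset.Icc 1 T, E t i j with hAdef
    have hA0 : ∀ T i j, 0 ≤ A T i j := fun T i j => mul_nonneg (by positivity)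
      (Finset.sum_nonneg fun t ht => hE0 t (Finset.mem_Icc.1 ht).1 i j)
    have havg : ∀ (T : ℕ) (f : ℕ → ℝ), (∀ t, 1 ≤ t → f t ≤ 1) →
        1 / (T : ℝ) * ∑ t ∈ Finset.Icc 1 T, f t ≤ 1 := fun T f hf => by
      have : ∑ t ∈ Finset.Icc 1 T, f t ≤ T := by
        simpa using Finset.sum_le_sum fun t (ht : t ∈ Finset.Icc 1 T) =>
          hf t (Finset.mem_Icc.1 ht).1
      rw [one_div_mul_eq_div]
      exact div_le_one_of_le₀ this (by positivity)
    have hAr : ∀ T i, ∑ j, A T i j ≤ 1 := fun T i => by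
      simp only [hAdef]
      rw [← Finset.mul_sum, Finset.sum_comm]
      exact havg T _ fun t ht => hEr t ht i
    have hAc : ∀ T j, ∑ i, A T i j ≤ 1 := fun T j => by
      simp only [hAdef]
      rw [← Finset.mul_sum, Finset.sum_comm]
      exact havg T _ fun t ht => hEc t ht j
    have hval : ∀ T : ℕ, (fun i => (1 / (T : ℝ)) * ∑ t ∈ Finset.Icc 1 T,
        ∫ ω, successes (Y t ω) (S t ω) i ∂μ) = fun i => ∑ j, A T i j * p i j := by
      intro T
      funext i
      rw [Finset.sum_congr rfl fun t ht => hX t (Finset.mem_Icc.1 ht).1 i, Finset.sum_comm,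
        Finset.mul_sum]
      refine Finset.sum_congr rfl fun j _ => ?_
      simp only [hAdef]
      rw [← Finset.sum_mul]
      ring
    unfold objective
    simp only [hval]
    refine liminf_le_of_le ?_ fun b hb => ?_
    -- A real `liminf` needs a lower bound; monotonicity supplies `φ 0`.
    · refine ⟨φ 0, eventually_map.2 (Eventually.of_forall fun T => ?_)⟩
      have hmem := sum_mul_mem_cube (hA0 T) (hAr T) hp
      exact hφ.mono (fun i => by simp) hmem fun i => (hmem i).1
    · obtain ⟨T, hT⟩ := hb.exists
      exact hT.trans (h _ (hA0 T) (hAr T) (hAc T))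

/-! ### The choice of parameters -/

lemma Run.phiOpt_sub_le {n m : ℕ} {φ : (Fin n → ℝ) → ℝ} {B V η ε : ℝ}
    {q : ℕ → Fin n → Fin m → ℝ} {Ω : Type u} [MeasurableSpace Ω] {μ : Measure Ω}
    (R : Run φ B V η ε q μ) [IsProbabilityMeasure μ] (hφ : IsUtility φ B)
    (hn : 0 < n) (hm : 0 < m) (hV : 0 < V) (hη : 0 < η) (hε : 0 < ε)
    (hεs : ε < 1 / ((max n m : ℕ) : ℝ)) {T₀ T : ℕ} (hT₀ : 1 ≤ T₀) (hT : 1 ≤ T)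
    {p : Fin n → Fin m → ℝ} (hq : ∀ t, T₀ ≤ t → t < T₀ + T → q t = p) :
    phiOpt φ p - φ (R.mean T₀ T) ≤
      n / V
      + 9 * η * n * m * ((max n m : ℕ) : ℝ) ^ 2 / (2 * ε * V) * (B * V + 1) ^ 2
      + ε * n * m * ((max n m : ℕ) : ℝ) * (B * V + 1) / V
      + ((max n m : ℕ) : ℝ) / (η * V * T) * Real.log (1 / ε)
      + n * (B * V + 1) ^ 2 / (2 * V * T)
      + n * B * (B * V + 1) / T := by
  have hs : (0 : ℝ) < (max n m : ℕ) := by exact_mod_cast hn.trans_le (le_max_left n m)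
  have hp : ∀ i j, 0 ≤ p i j ∧ p i j ≤ 1 := fun i j => by
    rw [← hq T₀ le_rfl (by omega)]
    exact ⟨R.success.nonneg hT₀ i j, R.success.le_one hT₀ i j⟩
  rw [sub_le_iff_le_add]
  refine phiOpt_le hφ hp fun A hA hr hc => ?_
  rw [← sub_le_iff_le_add]
  exact R.utility_bound hφ hn hm hV hη hε ((lt_div_iff₀ hs).1 hεs).le hT₀ hT hq hA hr hc

/-- These are the terms that do not decay with the horizon. With `K / V ≤ M` they are of orders
`1/V`, `ηV/ε` and `ε`, all `O(δ)`. The finite horizon uses them with `δ = T^{-1/3}`. -/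
lemma stationary_terms_le {n m s c₁ c₂ δ V η ε K M : ℝ} (hn : 0 ≤ n) (hm : 0 ≤ m) (hs : 0 ≤ s)
    (hc₁ : 0 < c₁) (hc₂ : 0 < c₂) (hδ : 0 < δ) (hV₁ : c₁ / δ ≤ V) (hV₂ : V ≤ c₂ / δ)
    (hε₁ : c₁ * δ ≤ ε) (hε₂ : ε ≤ c₂ * δ) (hη : η ≤ c₂ * δ ^ 3) (hK₀ : 0 ≤ K)
    (hK : K ≤ M * V) :
    n / V + 9 * η * n * m * s ^ 2 / (2 * ε * V) * K ^ 2 + ε * n * m * s * K / V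
      ≤ (n / c₁ + 9 / 2 * n * m * s ^ 2 * (c₂ ^ 2 / c₁ * M ^ 2) + n * m * s * (c₂ * M)) * δ := by
  have hV : 0 < V := lt_of_lt_of_le (by positivity) hV₁
  have hε : 0 < ε := lt_of_lt_of_le (by positivity) hε₁
  have hM : K / V ≤ M := (div_le_iff₀ hV).2 hK
  have hM0 : 0 ≤ M := le_trans (by positivity) hM
  have h1 : n / V ≤ n / c₁ * δ := by
    calc n / V ≤ n / (c₁ / δ) := by gcongr
      _ = n / c₁ * δ := by field_simp
  have h2 : 9 * η * n * m * s ^ 2 / (2 * ε * V) * K ^ 2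
      ≤ 9 / 2 * n * m * s ^ 2 * (c₂ ^ 2 / c₁ * M ^ 2) * δ := by
    calc 9 * η * n * m * s ^ 2 / (2 * ε * V) * K ^ 2
        = 9 / 2 * n * m * s ^ 2 * (η / ε * (V * (K / V) ^ 2)) := by field_simp
      _ ≤ 9 / 2 * n * m * s ^ 2 * ((c₂ * δ ^ 3) / (c₁ * δ) * (c₂ / δ * M ^ 2)) := by gcongr
      _ = _ := by field_simp
  have h3 : ε * n * m * s * K / V ≤ n * m * s * (c₂ * M) * δ := by
    calc ε * n * m * s * K / V = n * m * s * (ε * (K / V)) := by ring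
      _ ≤ n * m * s * (c₂ * δ * M) := by gcongr
      _ = _ := by ring
  linarith

/-- Here `r = T^{1/3}`. As `ηT ≥ c₁`, the divergence term is `O(log r / r)`; the other two are
`O(V/T) = O(r⁻²)`, weakened to `1/r`. -/
lemma transient_terms_le {n s B c₁ c₂ r V η ε K M : ℝ} (hn : 0 ≤ n) (hs : 0 ≤ s)
    (hB : 0 ≤ B) (hc₁ : 0 < c₁) (hc₂ : 0 < c₂) (hr : 1 ≤ r) (hV₁ : c₁ * r ≤ V) (hV₂ : V ≤ c₂ * r)
    (hε₁ : c₁ / r ≤ ε) (hε : ε ≤ 1) (hη : c₁ / r ^ 3 ≤ η) (hK₀ : 0 ≤ K) (hK : K ≤ M * V) :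
    s / (η * V * r ^ 3) * Real.log (1 / ε) + n * K ^ 2 / (2 * V * r ^ 3) + n * B * K / r ^ 3
      ≤ (s / c₁ ^ 2 * (Real.log r + |Real.log c₁|) + (n / 2 * M ^ 2 * c₂ + n * B * M * c₂)) / r := by
  have hr0 : 0 < r := by linarith
  have hV : 0 < V := lt_of_lt_of_le (by positivity) hV₁
  have hε0 : 0 < ε := lt_of_lt_of_le (by positivity) hε₁
  have hη0 : 0 < η := lt_of_lt_of_le (by positivity) hη
  have hM : K / V ≤ M := (div_le_iff₀ hV).2 hK
  have hM0 : 0 ≤ M := le_trans (by positivity) hM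
  have hr3 : r ≤ r ^ 2 := by nlinarith
  have hl0 : 0 ≤ Real.log (1 / ε) := Real.log_nonneg ((one_le_div hε0).2 hε)
  have hl : Real.log (1 / ε) ≤ Real.log r + |Real.log c₁| := by
    have e : Real.log (1 / (c₁ / r)) = Real.log r - Real.log c₁ := by
      rw [one_div_div, Real.log_div hr0.ne' hc₁.ne']
    have : Real.log (1 / ε) ≤ Real.log (1 / (c₁ / r)) :=
      Real.log_le_log (by positivity) (one_div_le_one_div_of_le (by positivity) hε₁)
    linarith [neg_abs_le (Real.log c₁)]
  have h1 : s / (η * V * r ^ 3) * Real.log (1 / ε)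
      ≤ s / c₁ ^ 2 * (Real.log r + |Real.log c₁|) / r := by
    calc s / (η * V * r ^ 3) * Real.log (1 / ε)
        ≤ s / (c₁ / r ^ 3 * (c₁ * r) * r ^ 3) * (Real.log r + |Real.log c₁|) := by gcongr
      _ = _ := by field_simp
  have h2 : n * K ^ 2 / (2 * V * r ^ 3) ≤ n / 2 * M ^ 2 * c₂ / r := by
    calc n * K ^ 2 / (2 * V * r ^ 3) = n / 2 * (K / V) ^ 2 * V / (r * r ^ 2) := by
          field_simp
      _ ≤ n / 2 * M ^ 2 * (c₂ * r) / (r * r) := by gcongr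
      _ = _ := by field_simp
  have h3 : n * B * K / r ^ 3 ≤ n * B * M * c₂ / r := by
    calc n * B * K / r ^ 3 = n * B * (K / V) * V / (r * r ^ 2) := by
          field_simp
      _ ≤ n * B * M * (c₂ * r) / (r * r) := by gcongr
      _ = _ := by field_simp
  rw [add_div, add_div]
  linarith

/-- With parameters in proportion to powers of `δ`, the gap over an infinite horizon is `O(δ)`. -/
lemma exists_infinite_horizon_bound {n m : ℕ} (hn : 0 < n) (hm : 0 < m) (B : ℝ) {c₁ c₂ : ℝ}
    (hc₁ : 0 < c₁) (hc : c₁ ≤ c₂) : ∃ C : ℝ, 0 < C ∧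
      ∀ φ : (Fin n → ℝ) → ℝ, IsUtility φ B →
      ∀ δ V η ε : ℝ, 0 < δ →
        c₁ / δ ≤ V → V ≤ c₂ / δ → c₁ * δ ≤ ε → ε ≤ c₂ * δ → ε < 1 / ((max n m : ℕ) : ℝ) →
        c₁ * δ ^ 3 ≤ η → η ≤ c₂ * δ ^ 3 →
      ∀ p : Fin n → Fin m → ℝ,
      ∀ (Ω : Type u) (_ : MeasurableSpace Ω) (μ : Measure Ω) (_ : IsProbabilityMeasure μ)
        (R : Run φ B V η ε (fun _ => p) μ),
        phiOpt φ p - liminf (fun T : ℕ => φ (R.mean 1 T)) atTop ≤ C * δ := by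
  have hc₂ : 0 < c₂ := hc₁.trans_le hc
  -- `c₁δ ≤ ε < 1` forces `V ≥ c₁/δ ≥ c₁²`, so `BV + 1 ≤ MV`. The absolute value keeps the constant
  -- positive before a utility is given.
  set M := |B| + 1 / c₁ ^ 2 with hM
  have hn' : (0 : ℝ) < n := by exact_mod_cast hn
  set s : ℝ := ((max n m : ℕ) : ℝ) with hs
  have hs1 : 1 ≤ s := by
    rw [hs]
    exact_mod_cast hn.trans_le (le_max_left n m)
  refine ⟨n / c₁ + 9 / 2 * n * m * s ^ 2 * (c₂ ^ 2 / c₁ * M ^ 2) + n * m * s * (c₂ * M),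
    by positivity, ?_⟩
  intro φ hφ δ V η ε hδ hV₁ hV₂ hε₁ hε₂ hεs hη₁ hη₂ p Ω mΩ μ hμ R
  have hB := hφ.nonneg hn
  have hV : 0 < V := lt_of_lt_of_le (by positivity) hV₁
  have hε : 0 < ε := lt_of_lt_of_le (by positivity) hε₁
  have hη : 0 < η := lt_of_lt_of_le (by positivity) hη₁
  have hδ1 : c₁ * δ ≤ 1 := hε₁.trans (hεs.le.trans ((div_le_one (by linarith)).2 hs1))
  have hK : B * V + 1 ≤ M * V := by
    have : 1 / c₁ ^ 2 * (c₁ / δ) ≤ 1 / c₁ ^ 2 * V := by gcongr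
    have h2 : 1 ≤ 1 / c₁ ^ 2 * (c₁ / δ) := by
      have e : 1 / c₁ ^ 2 * (c₁ / δ) = 1 / (c₁ * δ) := by field_simp
      rw [e]
      exact (one_le_div (by positivity)).2 hδ1
    rw [hM, abs_of_nonneg hB]
    linarith
  have hstat := stationary_terms_le (n := n) (m := m) (s := s) (by positivity) (by positivity)
    (by positivity) hc₁ hc₂ hδ hV₁ hV₂ hε₁ hε₂ hη₂ (by positivity) hK
  set C := n / c₁ + 9 / 2 * n * m * s ^ 2 * (c₂ ^ 2 / c₁ * M ^ 2) + n * m * s * (c₂ * M)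
  -- The coefficient of `1/T`; it disappears in the limit.
  set a := s / (η * V) * Real.log (1 / ε) + n * (B * V + 1) ^ 2 / (2 * V)
    + n * B * (B * V + 1) with ha
  have hlow : ∀ᶠ T : ℕ in atTop, phiOpt φ p - C * δ - a / T ≤ φ (R.mean 1 T) := by
    filter_upwards [eventually_ge_atTop 1] with T hT
    have h := R.phiOpt_sub_le hφ hn hm hV hη hε hεs le_rfl hT (p := p) fun _ _ _ => rfl
    have hT' : (0 : ℝ) < T := by exact_mod_cast hT
    have e : a / T = s / (η * V * T) * Real.log (1 / ε) + n * (B * V + 1) ^ 2 / (2 * V * T)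
        + n * B * (B * V + 1) / T := by
      simp only [ha]
      field_simp
    linarith
  have hlim : Tendsto (fun T : ℕ => phiOpt φ p - C * δ - a / T) atTop
      (nhds (phiOpt φ p - C * δ)) := by
    simpa using (tendsto_const_nhds (x := phiOpt φ p - C * δ)).sub
      (tendsto_const_div_atTop_nhds_zero_nat a)
  have hle := liminf_le_liminf hlow hlim.isBoundedUnder_ge (by
    refine IsCoboundedUnder.of_frequently_le (a := φ 1) (Frequently.of_forall fun T => ?_)
    have hmem := R.mean_mem_cube le_rfl T
    exact hφ.mono hmem (fun i => by simp) fun i => (hmem i).2)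
  rw [hlim.liminf_eq] at hle
  linarith

/-- With parameters in proportion to powers of `T`, the gap over a window of length `T` is
`O(log T / T^(1/3))`. -/
lemma exists_finite_horizon_bound {n m : ℕ} (hn : 0 < n) (hm : 0 < m) (B : ℝ) {c₁ c₂ : ℝ}
    (hc₁ : 0 < c₁) (hc : c₁ ≤ c₂) : ∃ C : ℝ, 0 < C ∧
      ∀ φ : (Fin n → ℝ) → ℝ, IsUtility φ B →
      ∀ T₀ T : ℕ, 1 ≤ T₀ → 2 ≤ T →
      ∀ V η ε : ℝ,
        c₁ * (T : ℝ) ^ (1 / 3 : ℝ) ≤ V → V ≤ c₂ * (T : ℝ) ^ (1 / 3 : ℝ) →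
        c₁ / (T : ℝ) ^ (1 / 3 : ℝ) ≤ ε → ε ≤ c₂ / (T : ℝ) ^ (1 / 3 : ℝ) →
        ε < 1 / ((max n m : ℕ) : ℝ) →
        c₁ / (T : ℝ) ≤ η → η ≤ c₂ / (T : ℝ) →
      ∀ (q : ℕ → Fin n → Fin m → ℝ) (p : Fin n → Fin m → ℝ),
        (∀ t, T₀ ≤ t → t < T₀ + T → q t = p) →
      ∀ (Ω : Type u) (_ : MeasurableSpace Ω) (μ : Measure Ω) (_ : IsProbabilityMeasure μ)
        (R : Run φ B V η ε q μ),
        phiOpt φ p - φ (R.mean T₀ T) ≤ C * (Real.log (T : ℝ) / (T : ℝ) ^ (1 / 3 : ℝ)) := by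
  have hc₂ : 0 < c₂ := hc₁.trans_le hc
  -- Here `V ≥ c₁ T^{1/3} ≥ c₁`, so again `BV + 1 ≤ MV`.
  set M := |B| + 1 / c₁ with hM
  have hn' : (0 : ℝ) < n := by exact_mod_cast hn
  set s : ℝ := ((max n m : ℕ) : ℝ) with hs
  have hs1 : 1 ≤ s := by
    rw [hs]
    exact_mod_cast hn.trans_le (le_max_left n m)
  set C₁ := n / c₁ + 9 / 2 * n * m * s ^ 2 * (c₂ ^ 2 / c₁ * M ^ 2) + n * m * s * (c₂ * M) with hC₁
  set C₂ := s / c₁ ^ 2 * |Real.log c₁| + (n / 2 * M ^ 2 * c₂ + n * |B| * M * c₂) with hC₂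
  have hC₁0 : 0 ≤ C₁ := by positivity
  have hC₂0 : 0 ≤ C₂ := by positivity
  have hlog2 : 0 < Real.log 2 := Real.log_pos (by norm_num)
  -- `T ≥ 2` gives `1 ≤ log T / log 2`, so the terms without a logarithm are absorbed at the price
  -- of `1 / log 2`.
  refine ⟨s / c₁ ^ 2 + (C₁ + C₂) / Real.log 2, by positivity, ?_⟩
  intro φ hφ T₀ T hT₀ hT V η ε hV₁ hV₂ hε₁ hε₂ hεs hη₁ hη₂ q p hq Ω mΩ μ hμ R
  have hB := hφ.nonneg hn
  have hT1 : (1 : ℝ) ≤ T := by exact_mod_cast (by omega : 1 ≤ T)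
  set r : ℝ := (T : ℝ) ^ (1 / 3 : ℝ) with hr
  have hr1 : 1 ≤ r := Real.one_le_rpow hT1 (by norm_num)
  have hr0 : 0 < r := by linarith
  have hr3 : (T : ℝ) = r ^ 3 := by
    rw [hr, ← Real.rpow_natCast, ← Real.rpow_mul (by linarith)]
    norm_num
  have hV : 0 < V := lt_of_lt_of_le (by positivity) hV₁
  have hε : 0 < ε := lt_of_lt_of_le (by positivity) hε₁
  have hη : 0 < η := lt_of_lt_of_le (by positivity) hη₁
  have hε1 : ε ≤ 1 := hεs.le.trans ((div_le_one (by linarith)).2 hs1)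
  have hK : B * V + 1 ≤ M * V := by
    have : 1 / c₁ * (c₁ * 1) ≤ 1 / c₁ * V := by
      gcongr
      exact le_trans (by gcongr) hV₁
    have h2 : 1 / c₁ * (c₁ * 1) = 1 := by field_simp
    rw [hM, abs_of_nonneg hB]
    linarith
  have hstat := stationary_terms_le (n := n) (m := m) (s := s) (c₁ := c₁) (c₂ := c₂) (δ := 1 / r)
    (by positivity) (by positivity) (by positivity) hc₁ hc₂ (by positivity)
    (by simpa using hV₁) (by simpa using hV₂) (by simpa [div_eq_mul_inv] using hε₁)
    (by simpa [div_eq_mul_inv] using hε₂)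
    (by simpa [div_eq_mul_inv, hr3] using hη₂) (by positivity) hK
  have htrans := transient_terms_le (n := n) (s := s) (B := B) (η := η) (by positivity) (by positivity) hB
    hc₁ hc₂ hr1 hV₁ hV₂ hε₁ hε1 (by rwa [hr3] at hη₁) (by positivity) hK
  have hgap := R.phiOpt_sub_le hφ hn hm hV hη hε hεs hT₀ (by omega) hq
  rw [hr3, ← hs] at hgap
  rw [← hC₁] at hstat
  have hlogr : Real.log r ≤ Real.log (T : ℝ) := by
    refine Real.log_le_log hr0 ?_
    rw [hr3]
    exact le_self_pow₀ hr1 (by norm_num)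
  have hlogT : 1 ≤ Real.log (T : ℝ) / Real.log 2 := by
    rw [one_le_div hlog2]
    exact Real.log_le_log (by norm_num) (by exact_mod_cast hT)
  have hfin : C₁ * (1 / r) + (s / c₁ ^ 2 * (Real.log r + |Real.log c₁|)
      + (n / 2 * M ^ 2 * c₂ + n * B * M * c₂)) / r
      ≤ (s / c₁ ^ 2 + (C₁ + C₂) / Real.log 2) * (Real.log (T : ℝ) / r) := by
    have e1 : C₁ * (1 / r) + (s / c₁ ^ 2 * (Real.log r + |Real.log c₁|)
        + (n / 2 * M ^ 2 * c₂ + n * B * M * c₂)) / r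
        = (s / c₁ ^ 2 * Real.log r + (C₁ + C₂)) / r := by
      rw [hC₂, abs_of_nonneg hB]
      ring
    have e2 : (s / c₁ ^ 2 + (C₁ + C₂) / Real.log 2) * (Real.log (T : ℝ) / r)
        = (s / c₁ ^ 2 * Real.log (T : ℝ) + (C₁ + C₂) * (Real.log (T : ℝ) / Real.log 2)) / r := by
      ring
    rw [e1, e2]
    have h1 : C₁ + C₂ ≤ (C₁ + C₂) * (Real.log (T : ℝ) / Real.log 2) :=
      le_mul_of_one_le_right (by positivity) hlogT
    gcongr
  linarith

end AdaptiveMAC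

theorem theorem1 (n m : ℕ) (hn : 0 < n) (hm : 0 < m) (B : ℝ) :
    -- The explicit bound over any window on which the success probabilities are constant.
    (∀ φ : (Fin n → ℝ) → ℝ, AdaptiveMAC.IsUtility φ B →
      ∀ V η ε : ℝ, 0 < V → 0 < η → 0 < ε → ε < 1 / ((max n m : ℕ) : ℝ) →
      ∀ T₀ T : ℕ, 1 ≤ T₀ → 1 ≤ T →
      ∀ (q : ℕ → Fin n → Fin m → ℝ) (p : Fin n → Fin m → ℝ),
        (∀ t, T₀ ≤ t → t < T₀ + T → q t = p) →
      ∀ (Ω : Type u) (_ : MeasurableSpace Ω) (μ : MeasureTheory.Measure Ω)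
        (_ : MeasureTheory.IsProbabilityMeasure μ) (R : AdaptiveMAC.Run φ B V η ε q μ),
        AdaptiveMAC.phiOpt φ p - φ (R.mean T₀ T) ≤
          n / V
          + 9 * η * n * m * ((max n m : ℕ) : ℝ) ^ 2 / (2 * ε * V) * (B * V + 1) ^ 2
          + ε * n * m * ((max n m : ℕ) : ℝ) * (B * V + 1) / V
          + ((max n m : ℕ) : ℝ) / (η * V * T) * Real.log (1 / ε)
          + n * (B * V + 1) ^ 2 / (2 * V * T)
          + n * B * (B * V + 1) / T) ∧
    -- Infinite horizon: `V = Θ(1/δ)`, `ε = Θ(δ)`, `η = Θ(δ³)` give a gap `O(δ)`.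
    (∀ c₁ c₂ : ℝ, 0 < c₁ → c₁ ≤ c₂ → ∃ C : ℝ, 0 < C ∧
      ∀ φ : (Fin n → ℝ) → ℝ, AdaptiveMAC.IsUtility φ B →
      ∀ δ V η ε : ℝ, 0 < δ →
        c₁ / δ ≤ V → V ≤ c₂ / δ → c₁ * δ ≤ ε → ε ≤ c₂ * δ → ε < 1 / ((max n m : ℕ) : ℝ) →
        c₁ * δ ^ 3 ≤ η → η ≤ c₂ * δ ^ 3 →
      ∀ p : Fin n → Fin m → ℝ,
      ∀ (Ω : Type u) (_ : MeasurableSpace Ω) (μ : MeasureTheory.Measure Ω)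
        (_ : MeasureTheory.IsProbabilityMeasure μ)
        (R : AdaptiveMAC.Run φ B V η ε (fun _ => p) μ),
        AdaptiveMAC.phiOpt φ p
          - Filter.liminf (fun T : ℕ => φ (R.mean 1 T)) Filter.atTop ≤ C * δ) ∧
    -- Finite horizon: `η = Θ(1/T)`, `ε = Θ(1/T^{1/3})`, `V = Θ(T^{1/3})` give `O(log T / T^{1/3})`.
    (∀ c₁ c₂ : ℝ, 0 < c₁ → c₁ ≤ c₂ → ∃ C : ℝ, 0 < C ∧
      ∀ φ : (Fin n → ℝ) → ℝ, AdaptiveMAC.IsUtility φ B →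
      ∀ T₀ T : ℕ, 1 ≤ T₀ → 2 ≤ T →
      ∀ V η ε : ℝ,
        c₁ * (T : ℝ) ^ (1 / 3 : ℝ) ≤ V → V ≤ c₂ * (T : ℝ) ^ (1 / 3 : ℝ) →
        c₁ / (T : ℝ) ^ (1 / 3 : ℝ) ≤ ε → ε ≤ c₂ / (T : ℝ) ^ (1 / 3 : ℝ) →
        ε < 1 / ((max n m : ℕ) : ℝ) →
        c₁ / (T : ℝ) ≤ η → η ≤ c₂ / (T : ℝ) →
      ∀ (q : ℕ → Fin n → Fin m → ℝ) (p : Fin n → Fin m → ℝ),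
        (∀ t, T₀ ≤ t → t < T₀ + T → q t = p) →
      ∀ (Ω : Type u) (_ : MeasurableSpace Ω) (μ : MeasureTheory.Measure Ω)
        (_ : MeasureTheory.IsProbabilityMeasure μ) (R : AdaptiveMAC.Run φ B V η ε q μ),
        AdaptiveMAC.phiOpt φ p - φ (R.mean T₀ T) ≤
          C * (Real.log (T : ℝ) / (T : ℝ) ^ (1 / 3 : ℝ))) := by
  refine ⟨?_, ?_, ?_⟩
  · intro φ hφ V η ε hV hη hε hεs T₀ T hT₀ hT q p hq Ω _ μ _ R
    exact R.phiOpt_sub_le hφ hn hm hV hη hε hεs hT₀ hT hq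
  · intro c₁ c₂ hc₁ hc
    exact AdaptiveMAC.exists_infinite_horizon_bound hn hm B hc₁ hc
  · intro c₁ c₂ hc₁ hc
    exact AdaptiveMAC.exists_finite_horizon_bound hn hm B hc₁ hc
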